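/- **The prototile.** Let $v_k=e^{i(\pi/6+k\pi/3)}$ ($k=0,\dots,5$, indices mod $6$) be the vertices of the regular hexagon $H\subset\mathbb{C}=\mathbb{R}^2$ of side length $1$ centred at $0$. The prototile is $H$ with the following markings. * *Black stripes.* For neighbouring vertices put $p_{i,j}=v_i+\tfrac14(v_j-v_i)$. There are three black stripes: two short ones, joining $p_{1,0}$ to $p_{1,2}$ and $p_{4,3}$ to $p_{4,5}$ (they cut off the opposite vertices $v_1$ and $v_4$), and a long one, joining $p_{0,5}$ to $p_{2,3}$ (it joins the two remaining opposite edges and is displaced from the centre to one side). * *Flags.* At each vertex $v_k$ there is a flag pointing in the direction $\sigma_k\, i\, v_k$ (orthogonal to $v_k$), where $(\sigma_0,\dots,\sigma_5)=(-1,-1,1,-1,1,1)$. So the flags at $v_0$ and $v_5$ point towards each other, so do those at $v_2$ and $v_3$, and the flags at $v_1$ and $v_4$ both point in the direction $+1$. A *tile* is an image of the marked prototile under an isometry of the plane, orientation preserving or reversing (so mirror images are allowed). A *tiling* is a set $T$ of tiles whose hexagons cover the plane and have pairwise disjoint interiors. A tiling is *allowed* if it obeys the matching rules: * **R1**: black stripes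 are continuous across all edges: each point where a black stripe of a tile ends is also an end of a black stripe of another tile; * **R2**: for every edge of the tiling, the flags at its two ends, carried by the two tiles that meet the edge only in one of its endpoints, point in the same direction. **Nonperiodicity.** A *partial translational symmetry* of a set $T$ of tiles is an operation $x\mapsto Rx+e$, where $R$ is a rotation and the displacement $e\neq0$ satisfies $Re=e$ (in the plane this forces $R$ to be the identity), together with an infinite subset of $T$ that the operation maps onto itself. The tiles of this subset *participate* in the symmetry, and $|e|$ is its *spacing*. A set of partial translational symmetries is *independent* if the displacement of none of them is an integer linear combination of the displacements of the others. For a tile $t\in T$ let $S_t(r)$ be the largest size (possibly infinite) of an independent set of partial translational symmetries of $T$ with spacing less than $r$ in all of which $t$ participates. A tiling $T$ of the plane is *nonperiodic* if for every $r$ the tiles with $S_t(r)<2$ make up a positive fraction of all tiles: there is $c>0$ such that for all sufficiently large $\rho$, at least the fraction $c$ of the tiles of $T$ with centre at distance at most $\rho$ from the origin satisfy $S_t(r)<2$. **Theorem.** The prototile allows tilings of the plane, and the only tilings it allows are nonperiodic: there exists an allowed tiling, and every allowed tiling is nonperiodic. -/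

import Mathlib

/-! The plane is `ℂ`. The prototile is the regular hexagon with side length `1` centred at `0` that
has two vertical edges: its vertices are at the angles `30°, 90°, …, 330°`. -/

noncomputable section

namespace SocolarTaylor

/-- The vertices of the prototile, at the angles `30° + k * 60°`. -/
def vertex (k : Fin 6) : ℂ :=
  Complex.exp (((Real.pi / 6 + (k.val : ℝ) * (Real.pi / 3) : ℝ) : ℂ) * Complex.I)

/-- The (closed, regular) hexagon underlying the prototile. -/
def hexagon : Set ℂ := convexHull ℝ (Set.range vertex)

/-- The point of the edge with ends `vertex i`, `vertex j` at one quarter of the edge from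
`vertex i`. Here `i` and `j` are neighbouring vertices. -/
def edgePoint (i j : Fin 6) : ℂ := vertex i + (1 / 4 : ℂ) * (vertex j - vertex i)

/-- The three black stripes of the prototile, each given by its two ends on the boundary:
a short stripe cutting off the top vertex, a short stripe cutting off the bottom vertex, and a
long stripe that joins the two vertical edges, displaced upwards from the centre. -/
def blackStripes : Set (ℂ × ℂ) :=
  {(edgePoint 1 0, edgePoint 1 2),
   (edgePoint 4 3, edgePoint 4 5),
   (edgePoint 0 5, edgePoint 2 3)}

/-- The six boundary points of the prototile at which a black stripe ends (one on each edge). -/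
def stripeEnds : Set ℂ := {p | ∃ s ∈ blackStripes, p = s.1 ∨ p = s.2}

/-- The sense of the flag at each vertex: `1` for counterclockwise, `-1` for clockwise
(as seen from the centre of the prototile). -/
def flagSense : Fin 6 → ℝ := ![-1, -1, 1, -1, 1, 1]

/-- The unit vector in which the flag at a vertex points; it is orthogonal to the ray from the
centre through the vertex. The flags at the two right vertices point towards each other, so do
those at the two left vertices, and those at the top and the bottom vertex both point to
the right. -/
def flag (k : Fin 6) : ℂ := (flagSense k : ℂ) * Complex.I * vertex k

/-- A placed tile: the image of the marked prototile under an isometry of the plane, direct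
(a copy of the prototile) or indirect (a copy of its mirror image). No nontrivial isometry
preserves the marked prototile, so a placed tile is the same thing as the isometry. -/
abbrev PlacedTile : Type := ℂ ≃ᵃⁱ[ℝ] ℂ

/-- The region covered by a placed tile. -/
def PlacedTile.region (t : PlacedTile) : Set ℂ := t '' hexagon

/-- A space-filling tiling: the tiles cover the plane and do not overlap. -/
def IsTiling (T : Set PlacedTile) : Prop :=
  (⋃ t ∈ T, PlacedTile.region t) = Set.univ ∧
  ∀ s ∈ T, ∀ t ∈ T, s ≠ t →
    Disjoint (interior (PlacedTile.region s)) (interior (PlacedTile.region t))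

/-- Rule R1: black stripes are continuous across all edges, that is, wherever a black stripe of a
tile ends, a black stripe of another tile ends too. -/
def RuleR1 (T : Set PlacedTile) : Prop :=
  ∀ s ∈ T, ∀ p ∈ stripeEnds, ∃ t ∈ T, t ≠ s ∧ ∃ q ∈ stripeEnds, t q = s p

/-- Rule R2: flags at opposite ends of a tile edge point in the same direction. The tiles `s` and
`t` lie at the two ends of an edge: the edge of unit length that leaves the vertex `k` of `s`
radially outwards ends at the vertex `l` of `t`, and conversely. -/
def RuleR2 (T : Set PlacedTile) : Prop :=
  ∀ s ∈ T, ∀ t ∈ T, ∀ k l : Fin 6,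
    s (2 * vertex k) = t (vertex l) → t (2 * vertex l) = s (vertex k) →
      s.linearIsometryEquiv (flag k) = t.linearIsometryEquiv (flag l)

/-- The tilings of the plane that the prototile allows. -/
def IsAllowedTiling (T : Set PlacedTile) : Prop := IsTiling T ∧ RuleR1 T ∧ RuleR2 T

/-- The operation `x ↦ R x + e` of the plane, with `R` a rotation about the origin. -/
def rotateTranslate (R : Circle) (e : ℂ) : ℂ ≃ᵃⁱ[ℝ] ℂ :=
  (rotation R).toAffineIsometryEquiv.trans (AffineIsometryEquiv.constVAdd ℝ ℂ e)

/-- A partial translational symmetry of a set of tiles: an operation `x ↦ R x + e` and an infinite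
subset that it leaves invariant. As in a screw operation, the displacement `e ≠ 0` lies along the
axis of the rotation, `R e = e`. (A rotation about a point of the plane other than the origin also
has the form `x ↦ R x + e` with `e ≠ 0`, but displaces nothing; it is not translational.) -/
structure PartialTranslationalSymmetry (T : Set PlacedTile) where
  /-- the rotation part -/
  rot : Circle
  /-- the displacement -/
  disp : ℂ
  disp_ne_zero : disp ≠ 0
  rot_disp : (rot : ℂ) * disp = disp
  /-- the tiles that participate -/
  participants : Set PlacedTile
  participants_subset : participants ⊆ T
  participants_infinite : participants.Infinite
  invariant :
    (fun t : PlacedTile => t.trans (rotateTranslate rot disp)) '' participants = participants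

/-- The length of the displacement. -/
def PartialTranslationalSymmetry.spacing {T : Set PlacedTile}
    (p : PartialTranslationalSymmetry T) : ℝ := ‖p.disp‖

/-- No displacement is an integer linear combination of the displacements of the others. -/
def IndependentSymmetries {T : Set PlacedTile} (P : Set (PartialTranslationalSymmetry T)) : Prop :=
  ∀ p ∈ P, p.disp ∉ Submodule.span ℤ (PartialTranslationalSymmetry.disp '' (P \ {p}))

/-- `S_t(r)`: the number of independent partial translational symmetries with spacing less
than `r` in which the tile `t` participates. -/
def numIndependent (T : Set PlacedTile) (t : PlacedTile) (r : ℝ) : ℕ∞ :=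
  ⨆ (P : Set (PartialTranslationalSymmetry T))
    (_ : IndependentSymmetries P ∧ ∀ p ∈ P, p.spacing < r ∧ t ∈ p.participants), P.encard

/-- The tiles of `T` whose centre is at distance at most `ρ` from the origin. -/
def tilesWithin (T : Set PlacedTile) (ρ : ℝ) : Set PlacedTile := {t | t ∈ T ∧ ‖t 0‖ ≤ ρ}

/-- The fraction of the tiles of `T` within distance `ρ` of the origin that belong to `A`. -/
def fractionWithin (T A : Set PlacedTile) (ρ : ℝ) : ℝ :=
  ((tilesWithin T ρ ∩ A).ncard : ℝ) / ((tilesWithin T ρ).ncard : ℝ)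

/-- A tiling of the plane is nonperiodic if for every `r` the tiles with `S_t(r) < 2` make up a
positive fraction of all tiles (their lower density is positive). -/
def IsNonperiodic (T : Set PlacedTile) : Prop :=
  ∀ r : ℝ, ∃ c : ℝ, 0 < c ∧
    ∀ᶠ ρ : ℝ in Filter.atTop, c ≤ fractionWithin T {t | numIndependent T t r < 2} ρ

end SocolarTaylor

end

/-!
In an allowed tiling the hexagons form a honeycomb, because of R1: where a black stripe crosses the
edge of a tile there is another tile, and if it did not share the whole edge, it would be displaced
by half an edge, and a gap would be left that no further tile can fill
(`IsAllowedTiling.exists_neighbor`). So the tiling is a map from the triangular lattice `ℤ × ℤ` to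
the twelve states of a tile (`IsAllowedTiling.exists_eq_range`).

Give a tile one of three types, according to the direction of the edges that its long stripe joins.
Follow the stripes across the edges of a row of tiles: in a tile whose type is the direction of the
row the mark goes straight through, in a tile of one of the other types it changes sides, in a sense
that the type dictates. So R1 says that on each line of nearest neighbours the two types different
from the class of the line alternate, and R2 says the same of the lines in the three perpendicular
directions (`ObeysRules.isSolution`). Conversely every field of types with this property comes from
an allowed tiling (`IsSolution.exists_obeysRules`, `ObeysRules.isAllowedTiling`), and there is an
explicit one, `toeplitz`.

In particular two tiles in one of these twelve directions have equal types only if the type is the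
class of the direction. A finite search shows that then some site is a hub: its six neighbours have
the types of the directions in which they lie (`Admissible.exists_isHub`). Hubs propagate to the
sites at distance two (`IsHub.step`). Hence three of the four cosets of twice the lattice have
constant types, and the field on the fourth one has the same property again
(`IsSolution.exists_sublattice`), and so on: up to any level, the type of a site is determined by
the 2-adic leading term of its difference to a centre. The sites whose difference to the centre is
`2 ^ m * (1, 2 ^ m)`, modulo a large power of two, are on no line of sites of equal type with a
step shorter than `2 ^ m` (`IsSolution.exists_coset`).

A tile that participates in a partial translational symmetry is repeated along a whole line of
lattice points (`PartialTranslationalSymmetry.exists_forall_zsmul`). So for given `r` the tiles of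
such a coset participate in no symmetry of spacing less than `r`: for them the number of independent
symmetries is `0`. The coset is a positive fraction of the lattice (`exists_le_fractionWithin`).
-/

noncomputable section

namespace SocolarTaylor

/-! ### Fields of types on the triangular lattice -/

/-- The local condition on a field `a` of types on the triangular lattice. The lattice has the six
short vectors `±u, ±v, ±(v - u)`, of classes `i`, `i + 1`, `i + 2`; the six next longer vectors
`±(2v - u), ±(2u - v), ±(u + v)` are perpendicular to them and are given the same classes. Two
sites that differ by one of these twelve vectors have the same type only if this type is the class
of the vector. -/
structure Admissible (a : ℤ × ℤ → Fin 3) (u v : ℤ × ℤ) (i : Fin 3) : Prop where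
  short₀ : ∀ x, a x = a (x + u) → a x = i
  short₁ : ∀ x, a x = a (x + v) → a x = i + 1
  short₂ : ∀ x, a x = a (x + (v - u)) → a x = i + 2
  long₀ : ∀ x, a x = a (x + (v + v - u)) → a x = i
  long₁ : ∀ x, a x = a (x + (u + u - v)) → a x = i + 1
  long₂ : ∀ x, a x = a (x + (u + v)) → a x = i + 2

theorem fin3_add_one_add_one : ∀ {i : Fin 3}, i + 1 + 1 = i + 2 := by decide

theorem fin3_add_one_add_two : ∀ {i : Fin 3}, i + 1 + 2 = i := by decide

theorem fin3_add_one_add_one_add_one : ∀ {i : Fin 3}, i + 1 + 1 + 1 = i := by decide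

theorem neg_zsmul_sub (n : ℕ) (w : ℤ × ℤ) : -(n : ℤ) • w - w = (-(n : ℤ) - 1) • w := by
  rw [sub_smul, one_smul]

/-- The condition is symmetric under the rotation by `60°`. -/
theorem Admissible.rotate {a : ℤ × ℤ → Fin 3} {u v : ℤ × ℤ} {i : Fin 3}
    (h : Admissible a u v i) : Admissible a v (v - u) (i + 1) where
  short₀ := h.short₁
  short₁ x hx := by simpa [add_assoc] using h.short₂ x hx
  short₂ x hx := by
    have e : x + (v - u - v) + u = x := by abel
    have := h.short₀ (x + (v - u - v)) (by rw [e, hx])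
    rw [hx, this, fin3_add_one_add_two]
  long₀ x hx := by
    have e : x + (v - u + (v - u) - v) + (u + u - v) = x := by abel
    have := h.long₁ (x + (v - u + (v - u) - v)) (by rw [e, hx])
    rw [hx, this]
  long₁ x hx := by
    have e : v + v - (v - u) = u + v := by abel
    rw [e] at hx
    rw [h.long₂ x hx, fin3_add_one_add_one]
  long₂ x hx := by
    have e : v + (v - u) = v + v - u := by abel
    rw [e] at hx
    rw [h.long₀ x hx, fin3_add_one_add_two]

/-- A site is a hub if the type of each of its six neighbours is the class of the direction in
which the neighbour lies. -/
structure IsHub (a : ℤ × ℤ → Fin 3) (u v : ℤ × ℤ) (i : Fin 3) (x : ℤ × ℤ) : Prop where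
  pos₀ : a (x + u) = i
  neg₀ : a (x - u) = i
  pos₁ : a (x + v) = i + 1
  neg₁ : a (x - v) = i + 1
  pos₂ : a (x + (v - u)) = i + 2
  neg₂ : a (x - (v - u)) = i + 2

theorem IsHub.rotate {a : ℤ × ℤ → Fin 3} {u v x : ℤ × ℤ} {i : Fin 3}
    (h : IsHub a u v i x) : IsHub a v (v - u) (i + 1) x where
  pos₀ := h.pos₁
  neg₀ := h.neg₁
  pos₁ := by rw [h.pos₂, fin3_add_one_add_one]
  neg₁ := by rw [h.neg₂, fin3_add_one_add_one]
  pos₂ := by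
    rw [show x + (v - u - v) = x - u by abel, h.neg₀, fin3_add_one_add_two]
  neg₂ := by
    rw [show x - (v - u - v) = x + u by abel, h.pos₀, fin3_add_one_add_two]

theorem eq_of_ne_of_ne₀ : ∀ {i c : Fin 3}, c ≠ i + 1 → c ≠ i + 2 → c = i := by decide

theorem eq_of_ne_of_ne₁ : ∀ {i c : Fin 3}, c ≠ i → c ≠ i + 2 → c = i + 1 := by decide

theorem eq_of_ne_of_ne₂ : ∀ {i c : Fin 3}, c ≠ i → c ≠ i + 1 → c = i + 2 := by decide

/-- Each of the five unknown neighbours of `x + 2u` is determined by two sites of known type. -/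
theorem IsHub.step {a : ℤ × ℤ → Fin 3} {u v x : ℤ × ℤ} {i : Fin 3}
    (h : Admissible a u v i) (hx : IsHub a u v i x) : IsHub a u v i (x + (u + u)) := by
  have n1 : ∀ i : Fin 3, i ≠ i + 1 := by decide
  have n2 : ∀ i : Fin 3, i ≠ i + 2 := by decide
  have n12 : ∀ i : Fin 3, i + 1 ≠ i + 2 := by decide
  have b1 : a (x + (u + u) - v) = i + 1 := by
    apply eq_of_ne_of_ne₁
    · intro e
      have e1 : x + (u + u) - v + (v - u) = x + u := by abel
      have := h.short₂ (x + (u + u) - v) (by rw [e1, e, hx.pos₀])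
      exact n2 i (e.symm.trans this)
    · intro e
      have e1 : x - (v - u) + u = x + (u + u) - v := by abel
      have := h.short₀ (x - (v - u)) (by rw [e1, e, hx.neg₂])
      rw [hx.neg₂] at this
      exact n2 i this.symm
  have c2 : a (x + (u + u) + (v - u)) = i + 2 := by
    apply eq_of_ne_of_ne₂
    · intro e
      have e1 : x + u + v = x + (u + u) + (v - u) := by abel
      have := h.short₁ (x + u) (by rw [e1, e, hx.pos₀])
      rw [hx.pos₀] at this
      exact n1 i this
    · intro e
      have e1 : x + v + u = x + (u + u) + (v - u) := by abel
      have := h.short₀ (x + v) (by rw [e1, e, hx.pos₁])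
      rw [hx.pos₁] at this
      exact n1 i this.symm
  have c1 : a (x + (u + u) + v) = i + 1 := by
    apply eq_of_ne_of_ne₁
    · intro e
      have e1 : x + u + (u + v) = x + (u + u) + v := by abel
      have := h.long₂ (x + u) (by rw [e1, e, hx.pos₀])
      rw [hx.pos₀] at this
      exact n2 i this
    · intro e
      have e1 : x + (u + u) + (v - u) + u = x + (u + u) + v := by abel
      have := h.short₀ (x + (u + u) + (v - u)) (by rw [e1, e, c2])
      rw [c2] at this
      exact n2 i this.symm
  have b2 : a (x + (u + u) - (v - u)) = i + 2 := by
    apply eq_of_ne_of_ne₂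
    · intro e
      have e1 : x + u + (u + u - v) = x + (u + u) - (v - u) := by abel
      have := h.long₁ (x + u) (by rw [e1, e, hx.pos₀])
      rw [hx.pos₀] at this
      exact n1 i this
    · intro e
      have e1 : x + (u + u) - v + u = x + (u + u) - (v - u) := by abel
      have := h.short₀ (x + (u + u) - v) (by rw [e1, e, b1])
      rw [b1] at this
      exact n1 i this.symm
  refine ⟨?_, ?_, c1, b1, c2, b2⟩
  · apply eq_of_ne_of_ne₀
    · intro e
      have e1 : x + (u + u) + u + (v - u) = x + (u + u) + v := by abel
      have := h.short₂ (x + (u + u) + u) (by rw [e1, e, c1])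
      rw [e] at this
      exact n12 i this
    · intro e
      have e1 : x + (u + u) - (v - u) + v = x + (u + u) + u := by abel
      have := h.short₁ (x + (u + u) - (v - u)) (by rw [e1, e, b2])
      rw [b2] at this
      exact n12 i this.symm
  · rw [show x + (u + u) - u = x + u by abel, hx.pos₀]

/-- By the rotation symmetry, hubs propagate along the sublattice generated by `2u` and
`2(v - u)`. -/
theorem IsHub.sublattice {a : ℤ × ℤ → Fin 3} {u v x : ℤ × ℤ} {i : Fin 3}
    (h : Admissible a u v i) (hx : IsHub a u v i x) (p q : ℤ) :
    IsHub a u v i (x + (p • (u + u) + q • (v - u + (v - u)))) := by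
  have r3 : ∀ {u v x i}, IsHub a u v i x → IsHub a (-u) (-v) i x := fun {u v x i} k => by
    have := k.rotate.rotate.rotate
    rwa [show v - u - v = -u by abel, show -u - (v - u) = -v by abel,
      fin3_add_one_add_one_add_one] at this
  have h3 : ∀ {u v i}, Admissible a u v i → Admissible a (-u) (-v) i := fun {u v i} k => by
    have := k.rotate.rotate.rotate
    rwa [show v - u - v = -u by abel, show -u - (v - u) = -v by abel,
      fin3_add_one_add_one_add_one] at this
  have stepNeg : ∀ {u v x i}, Admissible a u v i → IsHub a u v i x →
      IsHub a u v i (x - (u + u)) := fun {u v x i} k kx => by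
    have := r3 ((r3 kx).step (h3 k))
    rwa [neg_neg, neg_neg, show x + (-u + -u) = x - (u + u) by abel] at this
  have r4 : ∀ {x}, IsHub a (v - u) (v - u - v) (i + 1 + 1) x → IsHub a u v i x := fun {x} k => by
    have := k.rotate.rotate.rotate.rotate
    rwa [show v - u - v - (v - u) = -v by abel, show -v - (v - u - v) = u - v by abel,
      show u - v - -v = u by abel, show u - (u - v) = v by abel,
      fin3_add_one_add_one_add_one, fin3_add_one_add_one_add_one] at this
  have hq : ∀ q : ℤ, IsHub a u v i (x + q • (v - u + (v - u))) := by
    intro q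
    induction q with
    | zero => simpa using hx
    | succ n ih =>
      have := r4 (ih.rotate.rotate.step h.rotate.rotate)
      rwa [add_assoc, ← add_one_zsmul] at this
    | pred n ih =>
      have := r4 (stepNeg h.rotate.rotate ih.rotate.rotate)
      rwa [add_sub_assoc, neg_zsmul_sub] at this
  have e : ∀ p : ℤ, x + (p • (u + u) + q • (v - u + (v - u)))
      = x + q • (v - u + (v - u)) + p • (u + u) := fun p => by abel
  rw [e]
  induction p with
  | zero => simpa using hq q
  | succ n ih =>
    have := ih.step h
    rwa [add_assoc, ← add_one_zsmul] at this
  | pred n ih =>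
    have := stepNeg h ih
    rwa [add_sub_assoc, neg_zsmul_sub] at this

set_option synthInstance.maxSize 20000 in
/-- The types of the nineteen sites at distance at most two from a given site cannot satisfy the
local condition unless one of the seven inner sites is a hub. The sites are listed in an order in
which the partial assignments die out quickly. -/
theorem no_hubless_patch :
    ∀ x0 : Fin 3,
    ∀ x1 : Fin 3, (x0 = x1 → x0 = 2) →
    ∀ x2 : Fin 3, (x0 = x2 → x0 = 1) ∧ (x2 = x1 → x2 = 0) →
    ∀ x3 : Fin 3, (x2 = x3 → x2 = 2) ∧ (x3 = x1 → x3 = 1) ∧ (x0 = x3 → x0 = 0) →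
    ∀ x4 : Fin 3, (x4 = x0 → x4 = 2) ∧ (x4 = x3 → x4 = 1) ∧ (x4 = x2 → x4 = 0) →
    ∀ x5 : Fin 3, (x5 = x1 → x5 = 2) ∧ (x4 = x5 → x4 = 2) →
    ∀ x6 : Fin 3, (x0 = x6 → x0 = 1) ∧ (x6 = x1 → x6 = 0) ∧ (x6 = x5 → x6 = 1) ∧ (x4 = x6 → x4 =
      0) ∧ ¬(x5 = 0 ∧ x0 = 0 ∧ x1 = 1 ∧ x4 = 1 ∧ x6 = 2 ∧ x2 = 2) →
    ∀ x7 : Fin 3, (x6 = x7 → x6 = 2) ∧ (x0 = x7 → x0 = 0) →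
    ∀ x8 : Fin 3, (x8 = x0 → x8 = 0) ∧ (x8 = x6 → x8 = 2) ∧ (x8 = x4 → x8 = 1) →
    ∀ x9 : Fin 3, (x7 = x9 → x7 = 0) ∧ (x1 = x9 → x1 = 2) ∧ (x6 = x9 → x6 = 1) →
    ∀ x10 : Fin 3, (x10 = x7 → x10 = 1) ∧ (x10 = x6 → x10 = 0) ∧ (x10 = x9 → x10 = 2) ∧ (x10 = x3
      → x10 = 1) ∧ ¬(x1 = 0 ∧ x10 = 0 ∧ x9 = 1 ∧ x0 = 1 ∧ x7 = 2 ∧ x3 = 2) →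
    ∀ x11 : Fin 3, (x11 = x0 → x11 = 1) ∧ (x11 = x10 → x11 = 0) ∧ (x11 = x3 → x11 = 2) ∧ ¬(x3 = 0
      ∧ x8 = 0 ∧ x6 = 1 ∧ x11 = 1 ∧ x10 = 2 ∧ x4 = 2) →
    ∀ x12 : Fin 3, (x12 = x3 → x12 = 0) ∧ (x11 = x12 → x11 = 1) →
    ∀ x13 : Fin 3, (x13 = x12 → x13 = 0) ∧ (x13 = x4 → x13 = 1) ∧ (x13 = x11 → x13 = 2) ∧ ¬(x2 = 0
      ∧ x11 = 0 ∧ x3 = 1 ∧ x13 = 1 ∧ x0 = 2 ∧ x12 = 2) →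
    ∀ x14 : Fin 3, (x14 = x7 → x14 = 2) ∧ (x14 = x0 → x14 = 1) →
    ∀ x15 : Fin 3,
    ∀ x16 : Fin 3, (x16 = x13 → x16 = 1) ∧ ¬(x4 = 0 ∧ x16 = 0 ∧ x0 = 1 ∧ x15 = 1 ∧ x8 = 2 ∧ x13 =
      2) →
    ∀ x17 : Fin 3, (x17 = x7 → x17 = 0) ∧ (x14 = x17 → x14 = 1) ∧ ¬(x6 = 0 ∧ x14 = 0 ∧ x7 = 1 ∧ x8
      = 1 ∧ x17 = 2 ∧ x0 = 2) →
    ∀ x18 : Fin 3, ¬(x0 = 0 ∧ x18 = 0 ∧ x10 = 1 ∧ x16 = 1 ∧ x14 = 2 ∧ x11 = 2) →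
      False := by
  decide

/-- Hubs exist; in fact every site is a hub or has a neighbour that is one. -/
theorem Admissible.exists_isHub {a : ℤ × ℤ → Fin 3} (h : Admissible a (1, 0) (1, 1) 0) :
    ∃ x, IsHub a (1, 0) (1, 1) 0 x := by
  by_contra hn
  have no : ∀ p q : ℤ, ¬(a ((p, q) + (1, 0)) = 0 ∧ a ((p, q) - (1, 0)) = 0 ∧
      a ((p, q) + (1, 1)) = 1 ∧ a ((p, q) - (1, 1)) = 1 ∧
      a ((p, q) + ((1, 1) - (1, 0))) = 2 ∧ a ((p, q) - ((1, 1) - (1, 0))) = 2) :=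
    fun p q ⟨h1, h2, h3, h4, h5, h6⟩ => hn ⟨(p, q), h1, h2, h3, h4, h5, h6⟩
  exact no_hubless_patch (a (0, 0)) (a (2, 1)) (h.long₂ (0, 0)) (a (1, -1))
    ⟨by exact h.long₁ (0, 0), h.long₀ (1, -1)⟩ (a (1, 0))
    ⟨h.short₂ (1, -1), h.short₁ (1, 0), h.short₀ (0, 0)⟩ (a (0, -1))
    ⟨h.short₂ (0, -1), h.short₁ (0, -1), h.short₀ (0, -1)⟩ (a (2, 0))
    ⟨h.short₂ (2, 0), h.long₂ (0, -1)⟩ (a (1, 1))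
    ⟨h.short₁ (0, 0), h.short₀ (1, 1), by exact h.long₁ (1, 1), h.long₀ (0, -1), by exact no 1 0⟩
    (a (1, 2)) ⟨h.short₂ (1, 1), h.long₀ (0, 0)⟩ (a (-1, 0))
    ⟨h.short₀ (-1, 0), h.long₂ (-1, 0), by exact h.long₁ (-1, 0)⟩ (a (2, 2))
    ⟨h.short₀ (1, 2), h.short₂ (2, 1), h.short₁ (1, 1)⟩ (a (0, 1))
    ⟨h.short₁ (0, 1), h.short₀ (0, 1), h.long₂ (0, 1), by exact h.long₁ (0, 1), by exact no 1 1⟩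
    (a (-1, -1)) ⟨h.short₁ (-1, -1), h.long₀ (-1, -1), h.long₂ (-1, -1), by exact no 0 0⟩
    (a (0, -2)) ⟨h.long₀ (0, -2), by exact h.long₁ (-1, -1)⟩ (a (-1, -2))
    ⟨h.short₀ (-1, -2), h.short₁ (-1, -2), h.short₂ (-1, -2), by exact no 0 (-1)⟩ (a (-1, 1))
    ⟨h.long₂ (-1, 1), by exact h.long₁ (-1, 1)⟩ (a (-2, -2)) (a (-2, -1))
    ⟨by exact h.long₁ (-2, -1), by exact no (-1) (-1)⟩ (a (0, 2))
    ⟨h.short₀ (0, 2), h.short₁ (-1, 1), by exact no 0 1⟩ (a (-2, 0)) (by exact no (-1) 0)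

/-! ### The hierarchical structure of a field of types -/

/-- The shortest lattice vectors of the classes `0, 1, 2`, at the angles `0°, 60°, 120°`. The
coordinates refer to the basis of the vectors at `0°` and `120°`. -/
def edgeDir : Fin 3 → ℤ × ℤ := ![(1, 0), (1, 1), (0, 1)]

/-- The next longer lattice vectors: `vertexDir k` is perpendicular to `edgeDir k`. -/
def vertexDir : Fin 3 → ℤ × ℤ := ![(1, 2), (-1, 1), (-2, -1)]

/-- How a marking passes through a tile along a line of tiles: if the type of the tile is the class
of the line (`d = 0`), the marking is unchanged, otherwise the type determines which of the two
states the marking has before the tile, and it has the other one behind the tile. -/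
def passes : Fin 3 → Bool → Bool → Bool :=
  ![fun s t => s == t, fun s t => s && !t, fun s t => !s && t]

/-- Along each lattice line in one of the directions `D k`, the tiles of the two types different
from `k` alternate. This is expressed by a marking `b k x` of the steps from `x` to `x + D k`. -/
def Alternates (a : ℤ × ℤ → Fin 3) (D : Fin 3 → ℤ × ℤ) : Prop :=
  ∃ b : Fin 3 → ℤ × ℤ → Bool, ∀ k x, passes (a x - k) (b k (x - D k)) (b k x)

theorem Alternates.eq_class {a : ℤ × ℤ → Fin 3} {D : Fin 3 → ℤ × ℤ} (h : Alternates a D)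
    (k : Fin 3) {x : ℤ × ℤ} (hx : a x = a (x + D k)) : a x = k := by
  obtain ⟨b, hb⟩ := h
  have h1 := hb k x
  have h2 := hb k (x + D k)
  rw [← hx, add_sub_cancel_right] at h2
  have key : ∀ (c k : Fin 3) (r s t : Bool),
      passes (c - k) r s → passes (c - k) s t → c = k := by decide
  exact key _ _ _ _ _ h1 h2

/-- The sites `x + 2z` inherit the alternation if the site halfway between any two consecutive ones
on a line lets the marking pass. -/
theorem Alternates.sublattice {a : ℤ × ℤ → Fin 3} {D : Fin 3 → ℤ × ℤ} (h : Alternates a D)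
    {x : ℤ × ℤ} (hx : ∀ k z, a (x + (z + z) + D k) = k) :
    Alternates (fun z => a (x + (z + z))) D := by
  obtain ⟨b, hb⟩ := h
  refine ⟨fun k z => b k (x + (z + z)), fun k z => ?_⟩
  have h1 := hb k (x + (z + z))
  have h2 := hb k (x + (z - D k + (z - D k)) + D k)
  rw [hx, add_sub_cancel_right,
    show x + (z - D k + (z - D k)) + D k = x + (z + z) - D k by abel] at h2
  have key : ∀ (k : Fin 3) (s t : Bool), passes (k - k) s t → s = t := by decide
  rw [← key _ _ _ h2] at h1
  exact h1

/-- The combinatorial form of the two matching rules. -/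
structure IsSolution (a : ℤ × ℤ → Fin 3) : Prop where
  edge : Alternates a edgeDir
  vertex : Alternates a vertexDir

theorem IsSolution.admissible {a : ℤ × ℤ → Fin 3} (h : IsSolution a) :
    Admissible a (1, 0) (1, 1) 0 where
  short₀ _ := h.edge.eq_class 0
  short₁ _ := h.edge.eq_class 1
  short₂ _ := h.edge.eq_class 2
  long₀ _ := h.vertex.eq_class 0
  long₁ x hx := by
    have e : x + ((1, 0) + (1, 0) - (1, 1)) + vertexDir 1 = x := by
      ext <;> simp [vertexDir]
    rw [hx]
    exact h.vertex.eq_class 1 (by rw [e, hx])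
  long₂ x hx := by
    have e : x + ((1, 0) + (1, 1)) + vertexDir 2 = x := by
      ext <;> simp [vertexDir]
    rw [hx]
    exact h.vertex.eq_class 2 (by rw [e, hx])

/-- Three of the four cosets of a sublattice of index four have constant types, and the types on
the fourth coset form a solution again. -/
theorem IsSolution.exists_sublattice {a : ℤ × ℤ → Fin 3} (h : IsSolution a) :
    ∃ x, (∀ k z, a (x + (edgeDir k + (z + z))) = k) ∧ IsSolution fun z => a (x + (z + z)) := by
  obtain ⟨x, hx⟩ := h.admissible.exists_isHub
  have hub : ∀ z : ℤ × ℤ, IsHub a (1, 0) (1, 1) 0 (x + (z + z)) := fun z => by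
    convert hx.sublattice h.admissible z.1 z.2 using 2
    ext <;> simp <;> ring
  have he : ∀ k z, a (x + (edgeDir k + (z + z))) = k := by
    intro k z
    rw [show x + (edgeDir k + (z + z)) = x + (z + z) + edgeDir k by abel]
    fin_cases k
    exacts [(hub z).pos₀, (hub z).pos₁, (hub z).pos₂]
  -- `vertexDir k` and `edgeDir k` agree modulo two
  have hc : ∀ k, ∃ c, vertexDir k = edgeDir k + (c + c) := by
    intro k
    fin_cases k
    exacts [⟨(0, 1), rfl⟩, ⟨(-1, 0), rfl⟩, ⟨(-1, -1), rfl⟩]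
  refine ⟨x, he, h.edge.sublattice fun k z => ?_, h.vertex.sublattice fun k z => ?_⟩
  · rw [add_assoc, add_comm (z + z), he]
  · obtain ⟨c, hc⟩ := hc k
    rw [hc, show x + (z + z) + (edgeDir k + (c + c)) = x + (edgeDir k + (z + c + (z + c))) by abel,
      he]

/-- Iterating: up to any level `N` there is a centre such that the type at a site depends only on
the odd part modulo two of the difference to the centre. -/
theorem IsSolution.exists_center (N : ℕ) : ∀ {a : ℤ × ℤ → Fin 3}, IsSolution a →
    ∃ x, ∀ i < N, ∀ k z, a (x + (2 ^ i : ℤ) • (edgeDir k + (z + z))) = k := by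
  induction N with
  | zero => exact fun _ => ⟨0, fun i hi => absurd hi (Nat.not_lt_zero i)⟩
  | succ N ih =>
    intro a h
    obtain ⟨x, hx, h'⟩ := h.exists_sublattice
    obtain ⟨y, hy⟩ := ih h'
    refine ⟨x + (y + y), fun i hi k z => ?_⟩
    cases i with
    | zero =>
      have := hx k (y + z)
      rwa [show x + (edgeDir k + (y + z + (y + z))) = x + (y + y) + (edgeDir k + (z + z)) by abel,
        ← one_smul ℤ (edgeDir k + (z + z)), ← pow_zero 2] at this
    | succ i =>
      have := hy i (by omega) k z
      rwa [add_add_add_comm, ← two_smul ℤ ((2 ^ i : ℤ) • _), smul_smul, ← pow_succ',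
        ← add_assoc] at this

/-- A nonzero lattice vector is a power of two times a vector whose coordinates are not both
even. -/
theorem exists_two_pow_smul_odd {e : ℤ × ℤ} (he : e ≠ 0) : ∃ (v : ℕ) (f : ℤ × ℤ),
    e = (2 ^ v : ℤ) • f ∧ (Odd f.1 ∨ Odd f.2) := by
  induction hn : e.1.natAbs + e.2.natAbs using Nat.strong_induction_on generalizing e with
  | _ n ih =>
    by_cases ho : Odd e.1 ∨ Odd e.2
    · exact ⟨0, e, by simp, ho⟩
    · rw [not_or, Int.not_odd_iff_even, Int.not_odd_iff_even] at ho
      obtain ⟨⟨p, hp⟩, ⟨q, hq⟩⟩ := ho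
      have h0 : p ≠ 0 ∨ q ≠ 0 := by
        by_contra h0
        exact he (Prod.ext (by simp; omega) (by simp; omega))
      obtain ⟨v, f, hf, hodd⟩ := ih (p.natAbs + q.natAbs) (by omega) (e := (p, q))
        (fun h => by simp only [Prod.mk_eq_zero] at h; omega) rfl
      refine ⟨v + 1, f, ?_, hodd⟩
      rw [pow_succ', mul_smul, ← hf]
      ext <;> simp <;> omega

theorem exists_two_pow_mul_odd {n : ℤ} (hn : n ≠ 0) : ∃ (i : ℕ) (c : ℤ), n = 2 ^ i * c ∧ Odd c := by
  obtain ⟨i, f, hf, hodd⟩ := exists_two_pow_smul_odd (e := (n, 0)) (by simpa using hn)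
  simp only [Prod.ext_iff, Prod.smul_fst, Prod.smul_snd, smul_eq_mul] at hf
  have h2 : f.2 = 0 := by simpa using hf.2.symm
  exact ⟨i, f.1, hf.1, hodd.resolve_right (by simp [h2])⟩

/-- The sites of a suitable coset of a sublattice are on no line of sites of equal type that has a
short direction. The coset is that of `2 ^ m * (1, 2 ^ m)` relative to a centre: no short vector is
proportional to `(1, 2 ^ m)`, not even modulo a suitable power of two. Hence the line through such
a site passes the centre at a distance that is visible to the types. -/
theorem IsSolution.exists_coset {a : ℤ × ℤ → Fin 3} (h : IsSolution a) {m : ℕ} (hm : 0 < m) :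
    ∃ (M : ℕ) (x : ℤ × ℤ), 0 < M ∧ ∀ z e : ℤ × ℤ, e ≠ 0 → |e.1| < 2 ^ m → |e.2| < 2 ^ m →
      ∃ j : ℤ, a (x + (M : ℤ) • z + j • e) ≠ a (x + (M : ℤ) • z) := by
  obtain ⟨c, hc⟩ := h.exists_center (3 * m + 2)
  set N := 3 * m + 2 with hN
  -- `hc` in coordinates
  have hc0 : ∀ {i : ℕ} {p q s t : ℤ}, i < N → Odd p → Even q → s = 2 ^ i * p → t = 2 ^ i * q →
      a (c + (s, t)) = 0 := by
    rintro i p q s t hi ⟨p, rfl⟩ ⟨q, rfl⟩ rfl rfl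
    rw [← hc i hi 0 (p, q)]
    congr 2
    ext <;> simp [edgeDir]
    all_goals ring
  have hc1 : ∀ {i : ℕ} {p q s t : ℤ}, i < N → Odd p → Odd q → s = 2 ^ i * p → t = 2 ^ i * q →
      a (c + (s, t)) = 1 := by
    rintro i p q s t hi ⟨p, rfl⟩ ⟨q, rfl⟩ rfl rfl
    rw [← hc i hi 1 (p, q)]
    congr 2
    ext <;> simp [edgeDir]
    all_goals ring
  have hc2 : ∀ {i : ℕ} {p q s t : ℤ}, i < N → Even p → Odd q → s = 2 ^ i * p → t = 2 ^ i * q →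
      a (c + (s, t)) = 2 := by
    rintro i p q s t hi ⟨p, rfl⟩ ⟨q, rfl⟩ rfl rfl
    rw [← hc i hi 2 (p, q)]
    congr 2
    ext <;> simp [edgeDir]
    all_goals ring
  refine ⟨2 ^ N, c + (2 ^ m, 2 ^ m * 2 ^ m), by positivity, fun z e he h1 h2 => ?_⟩
  have even_pow : ∀ {n : ℕ}, 0 < n → ∀ w : ℤ, Even (2 ^ n * w) := fun hn w =>
    (even_two.pow_of_ne_zero hn.ne').mul_right w
  have hpow : (2 ^ N : ℤ) = 2 ^ m * (2 ^ m * (2 ^ (m + 2))) := by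
    rw [← pow_add, ← pow_add, hN]; congr 1; omega
  have ht : a (c + (2 ^ m, 2 ^ m * 2 ^ m) + ((2 ^ N : ℕ) : ℤ) • z) = 0 := by
    rw [add_assoc]
    refine hc0 (i := m) (p := 1 + 2 ^ m * (2 ^ (m + 2) * z.1))
      (q := 2 ^ m * (1 + 2 ^ (m + 2) * z.2)) (by omega) (odd_one.add_even (even_pow hm _))
      (even_pow hm _) ?_ ?_ <;> push_cast <;> rw [hpow] <;> simp <;> ring
  obtain ⟨v, f, rfl, hf⟩ := exists_two_pow_smul_odd he
  simp only [Prod.smul_fst, Prod.smul_snd, smul_eq_mul] at h1 h2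
  have hle : ∀ {w : ℤ}, |2 ^ v * w| < 2 ^ m → |w| < 2 ^ m := fun {w} hw => by
    rw [abs_mul, abs_of_pos (by positivity)] at hw
    exact (le_mul_of_one_le_left (abs_nonneg w) (one_le_pow₀ (by norm_num))).trans_lt hw
  have hv : v < m := by
    have key : ∀ {w : ℤ}, |2 ^ v * w| < 2 ^ m → Odd w → v < m := fun {w} hw ho => by
      rw [abs_mul, abs_of_pos (by positivity)] at hw
      have : (1 : ℤ) ≤ |w| := Int.one_le_abs (by rintro rfl; simp at ho)
      exact (pow_lt_pow_iff_right₀ (by norm_num : (1 : ℤ) < 2)).1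
        ((le_mul_of_one_le_right (by positivity) this).trans_lt hw)
    exact hf.elim (key h1) (key h2)
  obtain ⟨g, hg⟩ : ∃ g : ℤ, (2 ^ m : ℤ) = 2 ^ v * (2 * g) :=
    ⟨2 ^ (m - v - 1), by rw [← pow_succ', ← pow_add]; congr 1; omega⟩
  have hsite : ∀ j : ℤ, c + (2 ^ m, 2 ^ m * 2 ^ m) + ((2 ^ N : ℕ) : ℤ) • z + j • (2 ^ v : ℤ) • f =
      c + (2 ^ m + 2 ^ N * z.1 + j * (2 ^ v * f.1),
        2 ^ m * 2 ^ m + 2 ^ N * z.2 + j * (2 ^ v * f.2)) := fun j => by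
    ext <;> simp <;> ring
  have hfst : 2 ^ m + 2 ^ N * z.1 + 1 * (2 ^ v * f.1) =
      2 ^ v * (f.1 + 2 * (g * (1 + 2 ^ m * 2 ^ (m + 2) * z.1))) := by
    linear_combination (1 + 2 ^ m * 2 ^ (m + 2) * z.1) * hg + z.1 * hpow
  have hsnd : 2 ^ m * 2 ^ m + 2 ^ N * z.2 + 1 * (2 ^ v * f.2) =
      2 ^ v * (f.2 + 2 * (g * (2 ^ m * (1 + 2 ^ (m + 2) * z.2)))) := by
    linear_combination (2 ^ m * (1 + 2 ^ (m + 2) * z.2)) * hg + z.2 * hpow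
  rw [ht]
  -- Unless `f.1` is odd and `f.2` is even, the next site on the line already has another type.
  by_cases hf1 : Odd f.1
  swap
  · refine ⟨1, ?_⟩
    rw [hsite, hc2 (hv.trans (by omega)) ((Int.not_odd_iff_even.1 hf1).add (even_two_mul _))
      ((hf.resolve_left hf1).add_even (even_two_mul _)) hfst hsnd]
    decide
  by_cases hf2 : Odd f.2
  · refine ⟨1, ?_⟩
    rw [hsite, hc1 (hv.trans (by omega)) (hf1.add_even (even_two_mul _))
      (hf2.add_even (even_two_mul _)) hfst hsnd]
    decide
  -- Choose `j` such that the first coordinate becomes divisible by `2 ^ N`.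
  obtain ⟨r, s, hrs⟩ : IsCoprime f.1 (2 ^ N : ℤ) :=
    (show IsCoprime f.1 2 by
      obtain ⟨k, hk⟩ := hf1
      exact ⟨1, -k, by rw [hk]; ring⟩).pow_right
  set K : ℤ := 1 + 2 ^ m * 2 ^ (m + 2) * z.1 with hK
  refine ⟨-(r * (2 * g * K)), ?_⟩
  rw [hsite]
  set S : ℤ := 2 ^ m * 2 ^ m + 2 ^ N * z.2 + -(r * (2 * g * K)) * (2 ^ v * f.2) with hS
  have hS1 : f.1 * S = 2 ^ m * (2 ^ m * f.1 - f.2) +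
      2 ^ N * (f.1 * z.2 - z.1 * f.2 + s * 2 ^ m * K * f.2) := by
    rw [hS]
    linear_combination (r * f.1 * K * f.2) * hg - (2 ^ m * K * f.2) * hrs + (z.1 * f.2) * hpow
  -- The second coordinate `S` is not: `2 ^ m * f.1 - f.2` is too small to be divisible by
  -- `2 ^ (2 * m + 2)`, and it is not zero because `e` is short. Hence the site has type `2`.
  have hdvd : ¬(2 ^ N : ℤ) ∣ S := by
    intro hd
    have h3 : (2 ^ N : ℤ) ∣ 2 ^ m * (2 ^ m * f.1 - f.2) :=
      (Int.dvd_add_left (dvd_mul_right _ _)).1 (hS1 ▸ hd.mul_left f.1)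
    rw [hpow] at h3
    have h4 := Int.dvd_of_mul_dvd_mul_left (by positivity) h3
    have b1 := hle h1
    have b2 := hle h2
    have h5 : 2 ^ m * f.1 - f.2 = 0 := by
      refine Int.eq_zero_of_abs_lt_dvd h4 ?_
      rw [abs_lt] at b1 b2 ⊢
      have hP : (0 : ℤ) < 2 ^ m := by positivity
      have e : (2 ^ (m + 2) : ℤ) = 2 ^ m * 4 := by rw [pow_add]; norm_num
      rw [e]
      constructor <;> nlinarith
    have h6 : f.2 = 2 ^ m * f.1 := by linarith
    rw [h6, abs_mul, abs_of_pos (by positivity)] at b2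
    have h7 : |f.1| < 1 := by
      by_contra h7
      exact absurd b2 (not_lt.2 (le_mul_of_one_le_right (by positivity) (not_lt.1 h7)))
    rw [Int.abs_lt_one_iff.1 h7] at hf1
    simp at hf1
  obtain ⟨i, q, hq, hodd⟩ := exists_two_pow_mul_odd (n := S) (by rintro h0; simp [h0] at hdvd)
  have hi : i < N := by
    by_contra hi
    exact hdvd (hq ▸ (pow_dvd_pow 2 (not_lt.1 hi)).mul_right q)
  obtain ⟨n, hn⟩ := Nat.exists_eq_add_of_lt hi
  rw [hc2 (p := 2 ^ (n + 1) * (2 ^ m * K * s)) hi (even_pow n.succ_pos _) hodd ?_ hq]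
  · decide
  · have e : (2 ^ N : ℤ) = 2 ^ i * 2 ^ (n + 1) := by rw [← pow_add, hn]; rfl
    linear_combination (r * K * f.1) * hg - (2 ^ m * K) * hrs + z.1 * hpow + (2 ^ m * K * s) * e

/-! ### States of a tile -/

/-- The twelve symmetries of the hexagon, which are also the states in which a tile can occupy a
given hexagon: `(j, false)` is the rotation by `j * 60°`, and `(j, true)` is the complex conjugation
followed by this rotation. -/
abbrev TileState : Type := Fin 6 × Bool

/-- The action of the symmetries on the vertices of the hexagon. -/
def TileState.vertexPerm (g : TileState) (k : Fin 6) : Fin 6 := if g.2 then g.1 - 1 - k else g.1 + k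

/-- The action of the symmetries on the edges of the hexagon; edge `k` joins the vertices `k - 1`
and `k`, so that its outward normal is at the angle `k * 60°`. -/
def TileState.edgePerm (g : TileState) (k : Fin 6) : Fin 6 := if g.2 then g.1 - k else g.1 + k

theorem TileState.exists_vertexPerm_eq :
    ∀ (g : TileState) (k : Fin 6), ∃ l, g.vertexPerm l = k := by decide

theorem TileState.exists_edgePerm_eq :
    ∀ (g : TileState) (k : Fin 6), ∃ l, g.edgePerm l = k := by decide

/-- The ends of an edge are carried to the ends of its image, in the reverse order by a
reflection. -/
theorem TileState.vertexPerm_eq : ∀ (g : TileState) (k : Fin 6),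
    g.vertexPerm k = (if g.2 then g.edgePerm k - 1 else g.edgePerm k) ∧
      g.vertexPerm (k - 1) = if g.2 then g.edgePerm k else g.edgePerm k - 1 := by decide

/-- Whether the black stripe that ends on edge `k` of a tile in state `g` ends near vertex `k`
(`true`) or near vertex `k - 1` (`false`). -/
def TileState.stripeBit (g : TileState) (k : Fin 6) : Bool :=
  let s : Fin 6 → Bool := ![true, true, false, false, true, false]
  if g.2 then !s (g.1 - k) else s (k - g.1)

/-- Whether the flag at vertex `k` of a tile in state `g` points counterclockwise. -/
def TileState.flagBit (g : TileState) (k : Fin 6) : Bool :=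
  let s : Fin 6 → Bool := ![false, false, true, false, true, true]
  if g.2 then !s (g.1 - 1 - k) else s (k - g.1)

/-- The type of a state: the direction modulo `180°` of the normals of the two edges that are joined
by the long black stripe. -/
def TileState.type (g : TileState) : Fin 3 := ![0, 1, 2, 0, 1, 2] g.1

/-- The index among the six directions of a class of directions. -/
def dirIndex : Fin 3 → Fin 6 := ![0, 1, 2]

/-- The six shortest lattice vectors, at the angles `k * 60°`. -/
def neighbor : Fin 6 → ℤ × ℤ := ![(1, 0), (1, 1), (0, 1), (-1, 0), (-1, -1), (0, -1)]

/-- The matching rules R1 and R2 for a configuration of tile states on the triangular lattice. -/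
structure ObeysRules (G : ℤ × ℤ → TileState) : Prop where
  stripe : ∀ x k, (G (x + neighbor k)).stripeBit (k + 3) = !(G x).stripeBit k
  flag : ∀ x k, (G (x + (neighbor k + neighbor (k + 1)))).flagBit (k + 3) = !(G x).flagBit k

theorem ObeysRules.isSolution {G : ℤ × ℤ → TileState} (h : ObeysRules G) :
    IsSolution fun x => (G x).type where
  edge := by
    refine ⟨fun k x => (G x).stripeBit (dirIndex k), fun k x => ?_⟩
    have key : ∀ (g : TileState) (k : Fin 3),
        passes (g.type - k) (!g.stripeBit (dirIndex k + 3)) (g.stripeBit (dirIndex k)) := by decide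
    have h1 := h.stripe (x - edgeDir k) (dirIndex k)
    rw [show neighbor (dirIndex k) = edgeDir k by fin_cases k <;> rfl, sub_add_cancel] at h1
    have h2 := key (G x) k
    rwa [h1, Bool.not_not] at h2
  vertex := by
    refine ⟨fun k x => (G x).flagBit (dirIndex k + 1), fun k x => ?_⟩
    have key : ∀ (g : TileState) (k : Fin 3), passes (g.type - k)
        (!g.flagBit (dirIndex k + 1 + 3)) (g.flagBit (dirIndex k + 1)) := by decide
    have h1 := h.flag (x - vertexDir k) (dirIndex k + 1)
    rw [show neighbor (dirIndex k + 1) + neighbor (dirIndex k + 1 + 1) = vertexDir k by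
      fin_cases k <;> rfl, sub_add_cancel] at h1
    have h2 := key (G x) k
    rwa [h1, Bool.not_not] at h2

/-- A state is determined by its type, by the side to which the long stripe is displaced, and by
the direction of the two parallel flags, and these can be prescribed. Since all other marks are
determined by the type, a field of types that solves the combinatorial problem can be realized. -/
theorem IsSolution.exists_obeysRules {a : ℤ × ℤ → Fin 3} (h : IsSolution a) :
    ∃ G : ℤ × ℤ → TileState, ObeysRules G := by
  obtain ⟨⟨b, hb⟩, ⟨c, hc⟩⟩ := h
  have ex : ∀ (t : Fin 3) (r s : Bool), ∃ g : TileState, g.type = t ∧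
      g.stripeBit (dirIndex t) = r ∧ g.flagBit (dirIndex t + 1) = s := by decide
  choose F hF1 hF2 hF3 using ex
  have keyS : ∀ (g : TileState) (k : Fin 3) (s t : Bool), passes (g.type - k) s t →
      (g.type = k → g.stripeBit (dirIndex k) = t) →
      g.stripeBit (dirIndex k) = t ∧ g.stripeBit (dirIndex k + 3) = !s := by decide
  have keyF : ∀ (g : TileState) (k : Fin 3) (s t : Bool), passes (g.type - k) s t →
      (g.type = k → g.flagBit (dirIndex k + 1) = t) →
      g.flagBit (dirIndex k + 1) = t ∧ g.flagBit (dirIndex k + 1 + 3) = !s := by decide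
  set G : ℤ × ℤ → TileState := fun x => F (a x) (b (a x) x) (c (a x) x) with hG
  have hS : ∀ x k, (G x).stripeBit (dirIndex k) = b k x ∧
      (G x).stripeBit (dirIndex k + 3) = !b k (x - edgeDir k) := fun x k => by
    refine keyS _ _ _ _ (by rw [hG, hF1]; exact hb k x) fun e => ?_
    rw [hG, hF1] at e
    subst e
    exact hF2 _ _ _
  have hV : ∀ x k, (G x).flagBit (dirIndex k + 1) = c k x ∧
      (G x).flagBit (dirIndex k + 1 + 3) = !c k (x - vertexDir k) := fun x k => by
    refine keyF _ _ _ _ (by rw [hG, hF1]; exact hc k x) fun e => ?_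
    rw [hG, hF1] at e
    subst e
    exact hF3 _ _ _
  have split : ∀ k : Fin 6, (∃ l, k = dirIndex l) ∨ ∃ l, k = dirIndex l + 3 := by decide
  have split' : ∀ k : Fin 6, (∃ l, k = dirIndex l + 1) ∨ ∃ l, k = dirIndex l + 1 + 3 := by decide
  have three : ∀ k : Fin 6, k + 3 + 3 = k := by decide
  have nS : ∀ k, neighbor (dirIndex k) = edgeDir k ∧ neighbor (dirIndex k + 3) = -edgeDir k := by
    decide
  have nV : ∀ k, neighbor (dirIndex k + 1) + neighbor (dirIndex k + 1 + 1) = vertexDir k ∧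
      neighbor (dirIndex k + 1 + 3) + neighbor (dirIndex k + 1 + 3 + 1) = -vertexDir k := by decide
  refine ⟨G, fun x k => ?_, fun x k => ?_⟩
  · obtain ⟨l, rfl⟩ | ⟨l, rfl⟩ := split k
    · rw [(nS l).1, (hS _ l).2, (hS _ l).1, add_sub_cancel_right]
    · rw [(nS l).2, three, (hS _ l).1, (hS _ l).2, Bool.not_not, sub_eq_add_neg]
  · obtain ⟨l, rfl⟩ | ⟨l, rfl⟩ := split' k
    · rw [(nV l).1, (hV _ l).2, (hV _ l).1, add_sub_cancel_right]
    · rw [(nV l).2, three, (hV _ l).1, (hV _ l).2, Bool.not_not, sub_eq_add_neg]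

/-! ### Construction of a solution -/

/-- The hierarchical field of types with centre `0`. On a horizontal line `q ≠ 0`, with `2 ^ v` the
largest power of two that divides `q`, the types different from `0` are at the multiples of
`2 ^ v`, where the types `1` (odd multiples) and `2` (even multiples) alternate. -/
def toeplitz (x : ℤ × ℤ) : Fin 3 :=
  if x.2 = 0 ∨ x.1 % 2 ^ padicValInt 2 x.2 ≠ 0 then 0
  else if x.1 / 2 ^ padicValInt 2 x.2 % 2 = 1 then 1 else 2

/-- The marking of the horizontal steps that shows the alternation of the field which has the type
`-k` at the centre and agrees with `toeplitz` elsewhere. On the line through the centre, all types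
except the one at the centre are the class of the line, and the centre determines the marking if
`k ≠ 0`. -/
def toeplitzMark (k : Fin 3) (x : ℤ × ℤ) : Bool :=
  if x.2 = 0 then (if k = 0 then true else if k = 1 then decide (0 ≤ x.1) else decide (x.1 < 0))
  else decide (x.1 / 2 ^ padicValInt 2 x.2 % 2 = 0)

theorem toeplitz_add_self (x : ℤ × ℤ) : toeplitz (x + x) = toeplitz x := by
  by_cases h : x.2 = 0
  · simp [toeplitz, h]
  · have h2 : x.2 + x.2 ≠ 0 := by omega
    have hv : padicValInt 2 (x.2 + x.2) = padicValInt 2 x.2 + 1 := by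
      rw [← two_mul, padicValInt.mul two_ne_zero h]
      simp [add_comm, padicValInt]
    have hm : (x.1 + x.1) % (2 ^ (padicValInt 2 x.2 + 1)) = 2 * (x.1 % 2 ^ padicValInt 2 x.2) := by
      rw [← two_mul, pow_succ', Int.mul_emod_mul_of_pos _ _ two_pos]
    have hd : (x.1 + x.1) / (2 ^ (padicValInt 2 x.2 + 1)) = x.1 / 2 ^ padicValInt 2 x.2 := by
      rw [← two_mul, pow_succ', Int.mul_ediv_mul_of_pos _ _ two_pos]
    simp [toeplitz, h, h2, hv, hm, hd]

theorem padicValInt_two_of_odd {q : ℤ} (h : q % 2 = 1) : padicValInt 2 q = 0 :=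
  padicValInt.eq_zero_of_not_dvd (by omega)

/-- On vectors that are not divisible by two, `toeplitz` is the class modulo two. -/
theorem toeplitz_odd {x : ℤ × ℤ} (h : Odd x.1 ∨ Odd x.2) :
    toeplitz x = if x.2 % 2 = 0 then 0 else if x.1 % 2 = 1 then 1 else 2 := by
  rw [Int.odd_iff, Int.odd_iff] at h
  split_ifs with h2 h1
  · rw [toeplitz, if_pos]
    by_cases h0 : x.2 = 0
    · exact Or.inl h0
    · refine Or.inr fun he => ?_
      have hv : padicValInt 2 x.2 ≠ 0 := fun hv => by
        have := padicValInt_dvd_iff (p := 2) 1 x.2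
        rw [hv] at this
        omega
      have := (dvd_pow_self 2 hv).trans (Int.dvd_of_emod_eq_zero he)
      omega
  · simp [toeplitz, padicValInt_two_of_odd (q := x.2) (by omega), h1,
      show x.2 ≠ 0 by rintro h0; simp [h0] at h2]
  · simp [toeplitz, padicValInt_two_of_odd (q := x.2) (by omega), h1,
      show x.2 ≠ 0 by rintro h0; simp [h0] at h2]

theorem toeplitz_passes (k : Fin 3) {x : ℤ × ℤ} (hx : x ≠ 0) :
    passes (toeplitz x) (toeplitzMark k (x - (1, 0))) (toeplitzMark k x) := by
  by_cases h : x.2 = 0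
  · have h1 : x.1 ≠ 0 := fun h1 => hx (Prod.ext h1 h)
    have h2 : (1 ≤ x.1) ↔ (0 ≤ x.1) := by omega
    have h3 : (x.1 < 1) ↔ (x.1 < 0) := by omega
    fin_cases k <;> simp [toeplitz, toeplitzMark, h, passes, h2, h3]
  · set m : ℤ := 2 ^ padicValInt 2 x.2 with hm
    have hm0 : 0 < m := by positivity
    have e := Int.mul_ediv_add_emod x.1 m
    have r0 := Int.emod_nonneg x.1 hm0.ne'
    have r1 := Int.emod_lt_of_pos x.1 hm0
    by_cases hr : x.1 % m = 0
    · have hd : (x.1 - 1) / m = x.1 / m - 1 := by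
        rw [Int.ediv_eq_iff_of_pos hm0]
        constructor <;> nlinarith
      obtain h2 | h2 := Int.emod_two_eq_zero_or_one (x.1 / m)
      · have h3 : (x.1 / m - 1) % 2 = 1 := by omega
        simp [toeplitz, toeplitzMark, h, ← hm, hr, hd, h2, h3, passes]
      · have h3 : (x.1 / m - 1) % 2 = 0 := by omega
        simp [toeplitz, toeplitzMark, h, ← hm, hr, hd, h2, h3, passes]
    · have hd : (x.1 - 1) / m = x.1 / m := by
        have : 0 < x.1 % m := lt_of_le_of_ne r0 (Ne.symm hr)
        rw [Int.ediv_eq_iff_of_pos hm0]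
        constructor <;> nlinarith
      simp [toeplitz, toeplitzMark, h, ← hm, hr, hd, passes]

/-- A unimodular map that respects the classes modulo two carries the alternation on the horizontal
lines to lines in other directions. -/
theorem toeplitz_alternates {D : Fin 3 → ℤ × ℤ} (M : Fin 3 → ℤ × ℤ →+ ℤ × ℤ)
    (hinj : ∀ k x, M k x = 0 → x = 0) (hD : ∀ k, M k (D k) = (1, 0))
    (hodd : ∀ k x, Odd x.1 ∨ Odd x.2 → toeplitz (M k x) = toeplitz x - k) :
    Alternates toeplitz D := by
  have hM : ∀ k x, x ≠ 0 → toeplitz (M k x) = toeplitz x - k := by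
    intro k x hx
    obtain ⟨v, f, rfl, hf⟩ := exists_two_pow_smul_odd hx
    clear hx
    induction v with
    | zero => simpa using hodd k f hf
    | succ v ih =>
      rw [pow_succ', mul_smul, two_smul, map_add, toeplitz_add_self, toeplitz_add_self, ih]
  refine ⟨fun k x => toeplitzMark k (M k x), fun k x => ?_⟩
  beta_reduce
  rw [map_sub, hD]
  by_cases hx : x = 0
  · subst hx
    fin_cases k <;> simp [toeplitz, toeplitzMark, passes]
  · rw [← hM k x hx]
    exact toeplitz_passes k fun h => hx (hinj k x h)

/-- The additive map of the lattice with the matrix `!![p, q; r, s]`. -/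
def latticeMap (p q r s : ℤ) : ℤ × ℤ →+ ℤ × ℤ where
  toFun x := (p * x.1 + q * x.2, r * x.1 + s * x.2)
  map_zero' := by simp
  map_add' x y := by ext <;> simp <;> ring

/-- The unimodular maps carry the directions `edgeDir k`, `vertexDir k` to the horizontal one, and
permute the classes modulo two cyclically. -/
theorem toeplitz_isSolution : IsSolution toeplitz where
  edge := by
    refine toeplitz_alternates
      ![latticeMap 1 0 0 1, latticeMap 0 1 (-1) 1, latticeMap 1 1 1 0] ?_ ?_ ?_
    · intro k x h
      have h := Prod.ext_iff.1 h
      fin_cases k <;> dsimp [latticeMap] at h <;>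
        exact Prod.ext (by dsimp; omega) (by dsimp; omega)
    · intro k; fin_cases k <;> simp [latticeMap, edgeDir]
    · intro k x h
      have h' := h
      rw [Int.odd_iff, Int.odd_iff] at h'
      rw [toeplitz_odd h, toeplitz_odd] <;> fin_cases k <;> simp [latticeMap, Int.odd_iff] <;>
        first | omega | (split_ifs <;> omega)
  vertex := by
    refine toeplitz_alternates
      ![latticeMap 1 0 (-2) 1, latticeMap 0 1 1 1, latticeMap (-1) 1 1 (-2)] ?_ ?_ ?_
    · intro k x h
      have h := Prod.ext_iff.1 h
      fin_cases k <;> dsimp [latticeMap] at h <;>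
        exact Prod.ext (by dsimp; omega) (by dsimp; omega)
    · intro k; fin_cases k <;> simp [latticeMap, vertexDir]
    · intro k x h
      have h' := h
      rw [Int.odd_iff, Int.odd_iff] at h'
      rw [toeplitz_odd h, toeplitz_odd] <;> fin_cases k <;> simp [latticeMap, Int.odd_iff] <;>
        first | omega | (split_ifs <;> omega)

/-! ### The hexagon and its symmetries -/

/-- The embedding of the triangular lattice in the plane: `emb x` is the centre of the hexagon at
the site `x` of the honeycomb that contains the prototile. -/
def emb : ℤ × ℤ →+ ℂ where
  toFun x := ⟨√3 * (x.1 - x.2 / 2), 3 / 2 * x.2⟩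
  map_zero' := by apply Complex.ext <;> simp
  map_add' x y := by apply Complex.ext <;> simp <;> ring

theorem emb_re (x : ℤ × ℤ) : (emb x).re = √3 * (x.1 - x.2 / 2) := rfl

theorem emb_im (x : ℤ × ℤ) : (emb x).im = 3 / 2 * x.2 := rfl

theorem sqrt3_pos : (0 : ℝ) < √3 := Real.sqrt_pos.2 (by norm_num)

theorem sqrt3_sq : √3 * √3 = (3 : ℝ) := Real.mul_self_sqrt (by norm_num)

/-- The norm form of the triangular lattice. -/
def normForm (x : ℤ × ℤ) : ℤ := x.1 ^ 2 - x.1 * x.2 + x.2 ^ 2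

theorem normSq_emb (x : ℤ × ℤ) : Complex.normSq (emb x) = 3 * normForm x := by
  rw [Complex.normSq_apply, emb_re, emb_im, normForm]
  push_cast
  linear_combination (x.1 - x.2 / 2 : ℝ) ^ 2 * sqrt3_sq

theorem emb_injective : Function.Injective emb := by
  intro x y h
  have h1 := congrArg Complex.re h
  have h2 := congrArg Complex.im h
  rw [emb_re, emb_re] at h1
  rw [emb_im, emb_im] at h2
  have h2' : (x.2 : ℝ) = y.2 := by linarith
  have h1' := mul_left_cancel₀ sqrt3_pos.ne' h1
  rw [h2'] at h1'
  exact Prod.ext (by exact_mod_cast (by linarith : (x.1 : ℝ) = y.1)) (by exact_mod_cast h2')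

/-- The point at distance `1` from the centre at the angle `30° + n * 60°`. -/
def vertexAt (n : ℤ) : ℂ := Complex.exp (((Real.pi / 6 + n * (Real.pi / 3) : ℝ) : ℂ) * Complex.I)

theorem vertex_eq_vertexAt (k : Fin 6) : vertex k = vertexAt k.val := by
  simp [vertex, vertexAt]

theorem vertexAt_congr {m n : ℤ} (h : m % 6 = n % 6) : vertexAt m = vertexAt n := by
  obtain ⟨c, hc⟩ := Int.dvd_of_emod_eq_zero (Int.emod_eq_emod_iff_emod_sub_eq_zero.1 h)
  rw [vertexAt, vertexAt,
    ← Complex.exp_periodic.int_mul c (((Real.pi / 6 + n * (Real.pi / 3) : ℝ) : ℂ) * Complex.I)]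
  congr 1
  rw [show m = n + 6 * c by omega]
  push_cast
  ring

theorem vertexAt_zero : vertexAt 0 = ⟨√3 / 2, 1 / 2⟩ := by
  rw [vertexAt, Complex.exp_mul_I, ← Complex.ofReal_cos, ← Complex.ofReal_sin]
  apply Complex.ext <;> simp

theorem vertexAt_one : vertexAt 1 = Complex.I := by
  rw [vertexAt, show (Real.pi / 6 + (1 : ℤ) * (Real.pi / 3) : ℝ) = Real.pi / 2 by push_cast; ring]
  push_cast
  exact Complex.exp_pi_div_two_mul_I

theorem vertexAt_two : vertexAt 2 = ⟨-(√3 / 2), 1 / 2⟩ := by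
  rw [vertexAt, show (Real.pi / 6 + (2 : ℤ) * (Real.pi / 3) : ℝ) = Real.pi - Real.pi / 6 by
    push_cast; ring, Complex.exp_mul_I, ← Complex.ofReal_cos, ← Complex.ofReal_sin,
    Real.cos_pi_sub, Real.sin_pi_sub]
  apply Complex.ext <;> simp

theorem vertexAt_add_three (n : ℤ) : vertexAt (n + 3) = -vertexAt n := by
  rw [vertexAt, vertexAt, ← Complex.exp_add_pi_mul_I]
  congr 1
  push_cast
  ring

/-- The six vectors `neighbor k + neighbor (k + 1)`, which point in the directions of the
vertices. -/
def corner (k : Fin 6) : ℤ × ℤ := neighbor k + neighbor (k + 1)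

theorem three_mul_vertex (k : Fin 6) : 3 * vertex k = emb (corner k) := by
  have h0 := vertexAt_zero
  have h1 := vertexAt_one
  have h2 := vertexAt_two
  have h3 := vertexAt_add_three 0
  have h4 := vertexAt_add_three 1
  have h5 := vertexAt_add_three 2
  rw [vertex_eq_vertexAt]
  norm_num at h3 h4 h5
  fin_cases k <;> simp only [Fin.reduceFinMk, Fin.isValue, Fin.zero_eta, Fin.mk_one,
    Nat.cast_zero, Nat.cast_one, Nat.cast_ofNat, h0, h1, h2, h3, h4, h5] <;>
    apply Complex.ext <;> simp [emb_re, emb_im, corner, neighbor] <;> ring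

theorem vertex_add_three (k : Fin 6) : vertex (k + 3) = -vertex k := by
  have key : ∀ k, corner (k + 3) = -corner k := by decide
  have h := three_mul_vertex (k + 3)
  rw [key, map_neg, ← three_mul_vertex] at h
  linear_combination h / 3

/-- The symmetry of the hexagon that a state stands for, as a linear isometry of the plane. -/
def TileState.iso (g : TileState) : ℂ ≃ₗᵢ[ℝ] ℂ :=
  (if g.2 then Complex.conjLIE else LinearIsometryEquiv.refl ℝ ℂ).trans
    (rotation (Circle.exp ((g.1.val : ℝ) * (Real.pi / 3))))

theorem TileState.iso_vertex (g : TileState) (k : Fin 6) :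
    g.iso (vertex k) = vertex (g.vertexPerm k) := by
  obtain ⟨j, f⟩ := g
  simp only [iso, vertexPerm, LinearIsometryEquiv.trans_apply, rotation_apply, Circle.coe_exp,
    vertex_eq_vertexAt]
  cases f
  · rw [if_neg (by simp), if_neg (by simp),
      vertexAt_congr (m := (j + k).val) (n := j.val + k.val) (by rw [Fin.val_add]; omega),
      LinearIsometryEquiv.coe_refl, id_eq, vertexAt, vertexAt, ← Complex.exp_add]
    congr 1
    push_cast
    ring
  · rw [if_pos rfl, if_pos rfl,
      vertexAt_congr (m := (j - 1 - k).val) (n := j.val - 1 - k.val)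
        (by rw [Fin.val_sub, Fin.val_sub]; simp; omega),
      Complex.conjLIE_apply, vertexAt, vertexAt, ← Complex.exp_conj, map_mul,
      Complex.conj_ofReal, Complex.conj_I, ← Complex.exp_add]
    congr 1
    push_cast
    ring

theorem linearIsometry_ext {f g : ℂ ≃ₗᵢ[ℝ] ℂ} (h0 : f (vertex 0) = g (vertex 0))
    (h1 : f (vertex 1) = g (vertex 1)) : f = g := by
  ext z
  have hz : z = (z.re * 2 / √3) • vertex 0 + (z.im - z.re / √3) • vertex 1 := by
    have h0 := vertexAt_zero
    have h1 := vertexAt_one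
    rw [vertex_eq_vertexAt, vertex_eq_vertexAt]
    simp only [Fin.val_zero, Fin.val_one, Nat.cast_zero, Nat.cast_one, h0, h1]
    have := sqrt3_pos.ne'
    apply Complex.ext <;> simp <;> field_simp
    ring
  rw [hz, map_add, map_add, map_smul, map_smul, map_smul, map_smul, h0, h1]

/-- The product of two symmetries of the hexagon. -/
def TileState.mul (g h : TileState) : TileState :=
  (if g.2 then g.1 - h.1 else g.1 + h.1, xor g.2 h.2)

theorem TileState.iso_mul (g h : TileState) : (g.mul h).iso = h.iso.trans g.iso := by
  have key : ∀ (g h : TileState) (k : Fin 6),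
      (g.mul h).vertexPerm k = g.vertexPerm (h.vertexPerm k) := by decide
  apply linearIsometry_ext <;>
    simp only [LinearIsometryEquiv.trans_apply, iso_vertex, key]

theorem TileState.iso_zero : TileState.iso (0, false) = LinearIsometryEquiv.refl ℝ ℂ := by
  have key : ∀ k, TileState.vertexPerm (0, false) k = k := by decide
  apply linearIsometry_ext <;> simp only [LinearIsometryEquiv.coe_refl, id_eq, iso_vertex, key]

theorem vertex_injective : Function.Injective vertex := by
  intro k l h
  have key : ∀ k l, corner k = corner l → k = l := by decide
  exact key k l (emb_injective (by rw [← three_mul_vertex, h, three_mul_vertex]))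

theorem TileState.iso_injective : Function.Injective TileState.iso := by
  intro g h e
  have key : ∀ g h : TileState, g.vertexPerm 0 = h.vertexPerm 0 → g.vertexPerm 1 = h.vertexPerm 1 →
      g = h := by decide
  refine key g h (vertex_injective ?_) (vertex_injective ?_) <;>
    rw [← iso_vertex, ← iso_vertex, e]

/-- The hexagon is the intersection of three strips, whose boundaries are the lines through opposite
edges. -/
theorem mem_hexagon_iff {z : ℂ} : z ∈ hexagon ↔
    |2 * (z.re / √3)| ≤ 1 ∧ |z.re / √3 + z.im| ≤ 1 ∧ |z.re / √3 - z.im| ≤ 1 := by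
  have h3 := sqrt3_pos.ne'
  have hv : ∀ k, (vertex k).re / √3 = ((corner k).1 - (corner k).2 / 2 : ℝ) / 3 ∧
      (vertex k).im = ((corner k).2 : ℝ) / 2 := by
    intro k
    have h1 := congrArg Complex.re (three_mul_vertex k)
    have h2 := congrArg Complex.im (three_mul_vertex k)
    simp [emb_re, emb_im] at h1 h2
    constructor
    · rw [div_eq_iff h3]; linarith
    · linarith
  constructor
  · intro hz
    have hc : Convex ℝ {z : ℂ | |2 * (z.re / √3)| ≤ 1 ∧ |z.re / √3 + z.im| ≤ 1 ∧
        |z.re / √3 - z.im| ≤ 1} := by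
      intro x hx y hy a b ha hb hab
      simp only [Set.mem_ofPred_eq, abs_le, Complex.add_re, Complex.add_im, Complex.real_smul,
        Complex.re_ofReal_mul, Complex.im_ofReal_mul, add_div, mul_div_assoc] at hx hy ⊢
      obtain ⟨⟨x1, x2⟩, ⟨x3, x4⟩, x5, x6⟩ := hx
      obtain ⟨⟨y1, y2⟩, ⟨y3, y4⟩, y5, y6⟩ := hy
      refine ⟨⟨?_, ?_⟩, ⟨?_, ?_⟩, ?_, ?_⟩ <;> nlinarith
    refine convexHull_min ?_ hc hz
    rintro _ ⟨k, rfl⟩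
    simp only [Set.mem_ofPred_eq, (hv k).1, (hv k).2]
    fin_cases k <;> simp [corner, neighbor] <;> norm_num [abs_le]
  · rintro ⟨h0, h1, h2⟩
    have hc : Convex ℝ hexagon := convex_convexHull ℝ _
    have mem : ∀ k, vertex k ∈ hexagon := fun k => subset_convexHull ℝ _ ⟨k, rfl⟩
    have hz : (0 : ℂ) ∈ hexagon := by
      have e : (1 / 2 : ℝ) • vertex 0 + (1 / 2 : ℝ) • vertex 3 = 0 := by
        have : vertex 3 = -vertex 0 := vertex_add_three 0
        rw [this, smul_neg, add_neg_cancel]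
      rw [← e]
      exact hc (mem 0) (mem 3) (by norm_num) (by norm_num) (by norm_num)
    -- the hexagon contains the triangle with the corners `0`, `vertex k`, `vertex l`
    have tri : ∀ (k l : Fin 6) (α β : ℝ), 0 ≤ α → 0 ≤ β → α + β ≤ 1 →
        z.re / √3 = α * (vertex k).re / √3 + β * (vertex l).re / √3 →
        z.im = α * (vertex k).im + β * (vertex l).im → z ∈ hexagon := by
      intro k l α β hα hβ hαβ hre him
      have e : z = α • vertex k + β • vertex l := by
        apply Complex.ext
        · rw [← add_div, div_left_inj' h3] at hre
          simpa using hre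
        · simpa using him
      rw [e]
      have := hc.sum_mem (t := Finset.univ) (w := ![α, β, 1 - α - β])
        (z := ![vertex k, vertex l, 0]) (by
          intro i _; fin_cases i <;> simp <;> linarith) (by simp [Fin.sum_univ_three])
        (by intro i _; fin_cases i <;> simp [mem, hz])
      simpa [Fin.sum_univ_three] using this
    simp only [mul_div_assoc, hv] at tri
    rw [abs_le] at h0 h1 h2
    obtain ⟨X, hX⟩ : ∃ X, X = z.re / √3 := ⟨_, rfl⟩
    rw [← hX] at h0 h1 h2 tri
    simp only [corner, neighbor] at tri
    rcases le_total 0 (X - z.im) with a | a <;> rcases le_total 0 (X + z.im) with b | b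
    · exact tri 5 0 (X - z.im) (X + z.im) a b (by linarith) (by simp; linarith) (by simp; linarith)
    · rcases le_total 0 X with c | c
      · exact tri 4 5 (-X - z.im) (2 * X) (by linarith) (by linarith) (by linarith)
          (by simp; linarith) (by simp; linarith)
      · exact tri 3 4 (-2 * X) (X - z.im) (by linarith) (by linarith) (by linarith)
          (by simp; linarith) (by simp; linarith)
    · rcases le_total 0 X with c | c
      · exact tri 0 1 (2 * X) (z.im - X) (by linarith) (by linarith) (by linarith)
          (by simp; linarith) (by simp; linarith)
      · exact tri 1 2 (X + z.im) (-2 * X) (by linarith) (by linarith) (by linarith)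
          (by simp; linarith) (by simp; linarith)
    · exact tri 2 3 (z.im - X) (-X - z.im) (by linarith) (by linarith) (by linarith)
        (by simp; linarith) (by simp; linarith)

theorem mem_interior_hexagon {z : ℂ} (h0 : |2 * (z.re / √3)| < 1) (h1 : |z.re / √3 + z.im| < 1)
    (h2 : |z.re / √3 - z.im| < 1) : z ∈ interior hexagon := by
  have ho : IsOpen ({z : ℂ | |2 * (z.re / √3)| < 1} ∩
      ({z : ℂ | |z.re / √3 + z.im| < 1} ∩ {z : ℂ | |z.re / √3 - z.im| < 1})) :=
    (isOpen_lt (by fun_prop) continuous_const).inter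
      ((isOpen_lt (by fun_prop) continuous_const).inter (isOpen_lt (by fun_prop) continuous_const))
  exact interior_maximal (fun z hz => mem_hexagon_iff.2 ⟨hz.1.le, hz.2.1.le, hz.2.2.le⟩) ho
    ⟨h0, h1, h2⟩

/-- The open disc inscribed in the hexagon. -/
theorem mem_interior_hexagon_of_norm_lt {z : ℂ} (hz : ‖z‖ < √3 / 2) : z ∈ interior hexagon := by
  have h3 := sqrt3_pos
  have hn : z.re * z.re + z.im * z.im < 3 / 4 := by
    rw [← Complex.normSq_apply, Complex.normSq_eq_norm_sq]
    nlinarith [norm_nonneg z, sqrt3_sq]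
  obtain ⟨X, hX⟩ : ∃ X, X = z.re / √3 := ⟨_, rfl⟩
  have hX' : z.re = X * √3 := by rw [hX, div_mul_cancel₀ _ h3.ne']
  have hn' : 3 * X ^ 2 + z.im ^ 2 < 3 / 4 := by
    rw [hX'] at hn
    nlinarith [sqrt3_sq]
  apply mem_interior_hexagon <;> rw [← hX, ← sq_lt_one_iff_abs_lt_one]
  · nlinarith [sq_nonneg z.im]
  · nlinarith [sq_nonneg (3 * X - z.im)]
  · nlinarith [sq_nonneg (3 * X + z.im)]

theorem norm_vertex (k : Fin 6) : ‖vertex k‖ = 1 := Complex.norm_exp_ofReal_mul_I _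

theorem norm_le_one_of_mem_hexagon {z : ℂ} (hz : z ∈ hexagon) : ‖z‖ ≤ 1 := by
  have : hexagon ⊆ Metric.closedBall 0 1 := by
    refine convexHull_min ?_ (convex_closedBall 0 1)
    rintro _ ⟨k, rfl⟩
    simp [norm_vertex]
  simpa using this hz

/-- The hexagons of the honeycomb cover the plane. -/
theorem exists_sub_emb_mem_hexagon (z : ℂ) : ∃ x, z - emb x ∈ hexagon := by
  have h3 := sqrt3_pos.ne'
  obtain ⟨q, hq⟩ : ∃ q, q = z.im * 2 / 3 := ⟨_, rfl⟩
  obtain ⟨p, hp⟩ : ∃ p, p = z.re / √3 + q / 2 := ⟨_, rfl⟩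
  have key : ∀ x : ℤ × ℤ, |2 * (p - x.1) - (q - x.2)| ≤ 1 → |(p - x.1) + (q - x.2)| ≤ 1 →
      |(p - x.1) - 2 * (q - x.2)| ≤ 1 → z - emb x ∈ hexagon := by
    intro x h0 h1 h2
    have e : (z - emb x).re / √3 = (p - x.1) - (q - x.2) / 2 := by
      rw [Complex.sub_re, emb_re, sub_div, mul_div_cancel_left₀ _ h3, hp]; ring
    have e' : (z - emb x).im = 3 / 2 * (q - x.2) := by
      rw [Complex.sub_im, emb_im, hq]; ring
    rw [mem_hexagon_iff, e, e']
    refine ⟨?_, ?_, ?_⟩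
    · convert h0 using 2; ring
    · convert h1 using 2; ring
    · convert h2 using 2; ring
  have p0 := Int.floor_le p
  have p1 := Int.lt_floor_add_one p
  have q0 := Int.floor_le q
  have q1 := Int.lt_floor_add_one q
  set m := ⌊p⌋
  set n := ⌊q⌋
  -- one of the four lattice points around `z` will do
  by_cases a : 2 * (p - m) - (q - n) ≤ 1
  · by_cases b : 2 * (q - n) - (p - m) ≤ 1
    · by_cases c : (p - m) + (q - n) ≤ 1
      · refine ⟨(m, n), key _ ?_ ?_ ?_⟩ <;> rw [abs_le] <;> constructor <;> linarith
      · refine ⟨(m + 1, n + 1), key _ ?_ ?_ ?_⟩ <;> push_cast <;> rw [abs_le] <;>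
          constructor <;> linarith
    · by_cases c : (q - n) - 2 * (p - m) ≤ 0
      · refine ⟨(m + 1, n + 1), key _ ?_ ?_ ?_⟩ <;> push_cast <;> rw [abs_le] <;>
          constructor <;> linarith
      · refine ⟨(m, n + 1), key _ ?_ ?_ ?_⟩ <;> push_cast <;> rw [abs_le] <;>
          constructor <;> linarith
  · by_cases c : (p - m) - 2 * (q - n) ≤ 0
    · refine ⟨(m + 1, n + 1), key _ ?_ ?_ ?_⟩ <;> push_cast <;> rw [abs_le] <;>
        constructor <;> linarith
    · refine ⟨(m + 1, n), key _ ?_ ?_ ?_⟩ <;> push_cast <;> rw [abs_le] <;>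
        constructor <;> linarith

theorem TileState.iso_hexagon (g : TileState) : g.iso '' hexagon = hexagon := by
  have h := (g.iso.toLinearEquiv : ℂ →ₗ[ℝ] ℂ).image_convexHull (Set.range vertex)
  change g.iso '' hexagon = _ at h
  rw [h]
  congr 1
  ext z
  constructor
  · rintro ⟨_, ⟨k, rfl⟩, rfl⟩
    exact ⟨_, (g.iso_vertex k).symm⟩
  · rintro ⟨k, rfl⟩
    obtain ⟨l, rfl⟩ := g.exists_vertexPerm_eq k
    exact ⟨_, ⟨l, rfl⟩, g.iso_vertex l⟩

/-! ### The marks of a tile -/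

/-- The point at which a black stripe may end on edge `k`: at a quarter of the edge, near vertex `k`
if `s` is true, near vertex `k - 1` otherwise. -/
def markPoint (k : Fin 6) (s : Bool) : ℂ := if s then edgePoint k (k - 1) else edgePoint (k - 1) k

/-- Twelve times `markPoint k s`, as a lattice vector. -/
def markVector (k : Fin 6) (s : Bool) : ℤ × ℤ :=
  if s then corner k + corner k + corner k + corner (k - 1)
  else corner (k - 1) + corner (k - 1) + corner (k - 1) + corner k

theorem twelve_mul_markPoint (k : Fin 6) (s : Bool) :
    12 * markPoint k s = emb (markVector k s) := by
  cases s <;> simp only [markPoint, markVector, edgePoint, map_add, ← three_mul_vertex,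
    if_true, Bool.false_eq_true, if_false] <;> ring

theorem TileState.iso_markPoint (g : TileState) (k : Fin 6) (s : Bool) :
    g.iso (markPoint k s) = markPoint (g.edgePerm k) (xor g.2 s) := by
  have hE : ∀ i j, g.iso (edgePoint i j) = edgePoint (g.vertexPerm i) (g.vertexPerm j) := by
    intro i j
    have : ∀ i j, edgePoint i j = vertex i + (1 / 4 : ℝ) • (vertex j - vertex i) := by
      intro i j; simp [edgePoint]
    rw [this, this, map_add, map_smul, map_sub, iso_vertex, iso_vertex]
  obtain ⟨k1, k2⟩ := g.vertexPerm_eq k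
  cases s <;> cases h : g.2 <;> simp [markPoint, hE, k1, k2, h]

theorem mem_stripeEnds_iff {p : ℂ} :
    p ∈ stripeEnds ↔ ∃ k, p = markPoint k (TileState.stripeBit (0, false) k) := by
  have h6 : ∀ P : Fin 6 → Prop, (∃ k, P k) ↔ P 0 ∨ P 1 ∨ P 2 ∨ P 3 ∨ P 4 ∨ P 5 := by
    intro P; simp [Fin.exists_fin_succ]
  rw [h6]
  simp only [stripeEnds, blackStripes, Set.mem_insert_iff, Set.mem_singleton_iff,
    Set.mem_ofPred_eq, exists_eq_or_imp, exists_eq_left]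
  change _ ↔ p = edgePoint 0 5 ∨ p = edgePoint 1 0 ∨ p = edgePoint 1 2 ∨ p = edgePoint 2 3 ∨
    p = edgePoint 4 3 ∨ p = edgePoint 4 5
  tauto

/-- The ends of the black stripes of a tile in state `g`. -/
theorem TileState.iso_stripeEnds (g : TileState) {z : ℂ} :
    (∃ p ∈ stripeEnds, g.iso p = z) ↔ ∃ k, z = markPoint k (g.stripeBit k) := by
  have key : ∀ (g : TileState) k,
      xor g.2 (TileState.stripeBit (0, false) k) = g.stripeBit (g.edgePerm k) := by decide
  simp only [mem_stripeEnds_iff]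
  constructor
  · rintro ⟨_, ⟨k, rfl⟩, rfl⟩
    exact ⟨g.edgePerm k, by rw [iso_markPoint, key g k]⟩
  · rintro ⟨k, rfl⟩
    obtain ⟨l, rfl⟩ := g.exists_edgePerm_eq k
    exact ⟨_, ⟨l, rfl⟩, by rw [iso_markPoint, key g l]⟩

theorem TileState.iso_I_mul (g : TileState) (z : ℂ) :
    g.iso (Complex.I * z) = (if g.2 then -1 else 1) * (Complex.I * g.iso z) := by
  simp only [iso, LinearIsometryEquiv.trans_apply, rotation_apply]
  cases g.2
  · simp only [Bool.false_eq_true, if_false, LinearIsometryEquiv.coe_refl, id_eq]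
    ring
  · simp only [if_true, Complex.conjLIE_apply, map_mul, Complex.conj_I]
    ring

/-- The flag at vertex `k` of a tile in state `g`. -/
theorem TileState.iso_flag (g : TileState) (k : Fin 6) : g.iso (flag k) =
    (if g.flagBit (g.vertexPerm k) then 1 else -1) * (Complex.I * vertex (g.vertexPerm k)) := by
  have key : ∀ (g : TileState) k,
      g.flagBit (g.vertexPerm k) = xor g.2 (TileState.flagBit (0, false) k) := by decide
  have hf : flag k = (if TileState.flagBit (0, false) k then (1 : ℝ) else -1) •
      (Complex.I * vertex k) := by
    fin_cases k <;> simp [flag, flagSense, flagBit]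
  rw [hf, map_smul, iso_I_mul, iso_vertex, key]
  cases g.2 <;> cases TileState.flagBit (0, false) k <;> simp

theorem emb_neighbor (k : Fin 6) : emb (neighbor k) = vertex k + vertex (k - 1) := by
  have key : ∀ k, corner k + corner (k - 1) = neighbor k + neighbor k + neighbor k := by decide
  have h := congrArg emb (key k)
  simp only [map_add, ← three_mul_vertex] at h
  linear_combination -h / 3

theorem TileState.iso_emb_neighbor (g : TileState) (k : Fin 6) :
    g.iso (emb (neighbor k)) = emb (neighbor (g.edgePerm k)) := by
  obtain ⟨k1, k2⟩ := g.vertexPerm_eq k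
  rw [emb_neighbor, emb_neighbor, map_add, iso_vertex, iso_vertex, k1, k2]
  cases g.2 <;> simp [add_comm]

/-! ### Placed tiles -/

/-- The tile in state `g` with centre `c`, relative to the frame given by a tile `F`. -/
def place (F : PlacedTile) (c : ℂ) (g : TileState) : PlacedTile :=
  (g.iso.toAffineIsometryEquiv.trans (AffineIsometryEquiv.constVAdd ℝ ℂ c)).trans F

theorem place_apply (F : PlacedTile) (c : ℂ) (g : TileState) (z : ℂ) :
    place F c g z = F (c + g.iso z) := rfl

theorem place_linear (F : PlacedTile) (c : ℂ) (g : TileState) (z : ℂ) :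
    (place F c g).linearIsometryEquiv z = F.linearIsometryEquiv (g.iso z) := rfl

theorem place_place (F : PlacedTile) (c d : ℂ) (g h : TileState) :
    place (place F c g) d h = place F (c + g.iso d) (g.mul h) := by
  ext z
  rw [place_apply, place_apply, place_apply, g.iso.map_add, TileState.iso_mul, add_assoc]
  rfl

theorem place_zero (F : PlacedTile) : place F 0 (0, false) = F := by
  ext z
  rw [place_apply, TileState.iso_zero, zero_add]
  rfl

theorem place_injective {F : PlacedTile} {c d : ℂ} {g h : TileState}
    (e : place F c g = place F d h) : c = d ∧ g = h := by
  have h0 := DFunLike.congr_fun e 0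
  rw [place_apply, place_apply, map_zero, map_zero, add_zero, add_zero] at h0
  have hc := F.injective h0
  refine ⟨hc, TileState.iso_injective ?_⟩
  ext z
  have hz := DFunLike.congr_fun e z
  rw [place_apply, place_apply, hc] at hz
  exact add_left_cancel (F.injective hz)

theorem interior_region (t : PlacedTile) : interior t.region = t '' interior hexagon :=
  (t.toHomeomorph.image_interior hexagon).symm

theorem dist_apply_center (t : PlacedTile) (z : ℂ) : dist (t z) (t 0) = ‖z‖ := by
  rw [t.dist_map, dist_zero_right]

theorem IsTiling.sqrt3_le_dist {T : Set PlacedTile} (h : IsTiling T) {s t : PlacedTile}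
    (hs : s ∈ T) (ht : t ∈ T) (hne : s ≠ t) : √3 ≤ dist (s 0) (t 0) := by
  by_contra hd
  have hd := not_le.1 hd
  -- the midpoint of the centres is an interior point of both tiles
  have mem : ∀ u : PlacedTile, dist (midpoint ℝ (s 0) (t 0)) (u 0) < √3 / 2 →
      midpoint ℝ (s 0) (t 0) ∈ interior u.region := by
    intro u hu
    obtain ⟨z, hz⟩ := u.surjective (midpoint ℝ (s 0) (t 0))
    rw [← hz, dist_apply_center] at hu
    rw [← hz, interior_region]
    exact ⟨z, mem_interior_hexagon_of_norm_lt hu, rfl⟩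
  refine Set.disjoint_left.1 (h.2 s hs t ht hne) (mem s ?_) (mem t ?_)
  · rw [dist_midpoint_left]; norm_num; linarith
  · rw [dist_midpoint_right]; norm_num; linarith

theorem IsTiling.exists_dist_le_one {T : Set PlacedTile} (h : IsTiling T) (z : ℂ) :
    ∃ t ∈ T, dist z (t 0) ≤ 1 := by
  have hz : z ∈ ⋃ t ∈ T, PlacedTile.region t := h.1 ▸ Set.mem_univ z
  simp only [Set.mem_iUnion] at hz
  obtain ⟨t, ht, w, hw, rfl⟩ := hz
  exact ⟨t, ht, by rw [dist_apply_center]; exact norm_le_one_of_mem_hexagon hw⟩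

/-! ### Tilings that obey R1 are honeycombs -/

theorem markPoint_zero (s : Bool) : markPoint 0 s = ⟨√3 / 2, if s then 1 / 4 else -1 / 4⟩ := by
  have h := twelve_mul_markPoint 0 s
  have h1 := congrArg Complex.re h
  have h2 := congrArg Complex.im h
  cases s <;> simp [emb_re, emb_im, markVector, corner, neighbor] at h1 h2 <;>
    apply Complex.ext <;> simp <;> linarith

/-- Edge `0` is perpendicular to the real axis, so moving from one of its points into the left half
plane leads into the hexagon. -/
theorem eventually_mem_interior_hexagon (s : Bool) {w : ℂ} (hw : w.re < 0) :
    ∀ᶠ ε : ℝ in nhdsWithin 0 (Set.Ioi 0), markPoint 0 s + ε * w ∈ interior hexagon := by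
  have h3 := sqrt3_pos
  have e : (√3 / 2) / √3 = 1 / 2 := by rw [div_right_comm, div_self h3.ne']
  have small : ∀ a b c : ℝ, |a| < c → ∀ᶠ ε : ℝ in nhdsWithin 0 (Set.Ioi 0), |a + ε * b| < c := by
    intro a b c h
    refine Filter.Eventually.filter_mono nhdsWithin_le_nhds ?_
    have : Filter.Tendsto (fun ε : ℝ => |a + ε * b|) (nhds 0) (nhds |a + 0 * b|) :=
      (Continuous.tendsto (by fun_prop) 0)
    exact this.eventually_lt_const (by simpa using h)
  have pos : ∀ᶠ ε : ℝ in nhdsWithin 0 (Set.Ioi 0), 0 < ε := eventually_mem_nhdsWithin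
  have h1 := small (1 / 2 + (if s then 1 / 4 else -1 / 4)) (w.re / √3 + w.im) 1
    (by cases s <;> norm_num [abs_lt])
  have h2 := small (1 / 2 - (if s then 1 / 4 else -1 / 4)) (w.re / √3 - w.im) 1
    (by cases s <;> norm_num [abs_lt])
  have h4 := small 0 (2 * (w.re / √3)) 2 (by norm_num)
  filter_upwards [pos, h1, h2, h4] with ε hε h1 h2 h4
  have hre : (markPoint 0 s + ε * w).re / √3 = 1 / 2 + ε * (w.re / √3) := by
    rw [markPoint_zero, Complex.add_re, Complex.re_ofReal_mul, add_div, e, mul_div_assoc]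
  have him : (markPoint 0 s + ε * w).im = (if s then 1 / 4 else -1 / 4) + ε * w.im := by
    rw [markPoint_zero, Complex.add_im, Complex.im_ofReal_mul]
  have hneg : ε * (w.re / √3) < 0 := mul_neg_of_pos_of_neg hε (div_neg_of_neg_of_pos hw h3)
  apply mem_interior_hexagon
  · rw [hre, abs_lt]
    rw [abs_lt] at h4
    constructor <;> linarith
  · rw [hre, him]
    convert h1 using 2
    ring
  · rw [hre, him]
    convert h2 using 2
    ring

/-- If two hexagons without common interior points share a mark point of an edge `0` of each,
then these edges lie on the same line, on opposite sides of which the two hexagons are. -/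
theorem eq_neg_one_of_disjoint {a : Circle} {c : ℂ} {s s' : Bool}
    (hd : ∀ z ∈ interior hexagon, (a : ℂ) * z + c ∉ interior hexagon)
    (h : (a : ℂ) * markPoint 0 s' + c = markPoint 0 s) : (a : ℂ) = -1 := by
  by_contra ha
  have hn : (a : ℂ).re * (a : ℂ).re + (a : ℂ).im * (a : ℂ).im = 1 := by
    rw [← Complex.normSq_apply, Circle.normSq_coe]
  have hre : -1 < (a : ℂ).re := by
    rcases lt_or_eq_of_le (by nlinarith [mul_self_nonneg (a : ℂ).im] : -1 ≤ (a : ℂ).re) with h | h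
    · exact h
    · refine absurd (Complex.ext ?_ ?_) ha
      · simp [← h]
      · simp only [← h] at hn
        simpa using hn
  have hinv : (a : ℂ) * (starRingEnd ℂ) a = 1 := by
    rw [Complex.mul_conj, Circle.normSq_coe, Complex.ofReal_one]
  have h1 := eventually_mem_interior_hexagon s (w := -(1 + a)) (by simp; linarith)
  have h2 := eventually_mem_interior_hexagon s' (w := -(1 + (starRingEnd ℂ) a)) (by simp; linarith)
  obtain ⟨ε, h1, h2⟩ := (h1.and h2).exists
  refine hd _ h2 ?_
  convert h1 using 1
  rw [← h]
  linear_combination (-(ε : ℂ)) * hinv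

/-- Two tiles without common interior points that share a mark point have parallel hexagons. They
share an edge, or one of the hexagons is displaced by half an edge along the other one. -/
theorem exists_eq_place_of_disjoint {s t : PlacedTile} (hd : Disjoint (interior s.region)
    (interior t.region)) {k l : Fin 6} {b b' : Bool} (h : s (markPoint k b) = t (markPoint l b')) :
    ∃ g c, t = place s c g ∧ (c = 2 * markPoint k b ∨ c = emb (neighbor k)) := by
  obtain ⟨s₁, hs₁⟩ : ∃ s₁, s₁ = place s 0 (k, false) := ⟨_, rfl⟩
  have hregion : ∀ (u : PlacedTile) (g : TileState) {z : ℂ}, z ∈ interior hexagon →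
      place u 0 g z ∈ interior u.region := by
    intro u g z hz
    have : (place u 0 g).region = u.region := by
      have e : ⇑(place u 0 g) = u ∘ g.iso := by ext z; simp [place_apply]
      rw [PlacedTile.region, e, Set.image_comp, g.iso_hexagon, PlacedTile.region]
    rw [← this, interior_region]
    exact ⟨z, hz, rfl⟩
  have k0 : ∀ k : Fin 6, TileState.edgePerm (k, false) 0 = k ∧
      TileState.edgePerm (k, true) 0 = k := by decide
  -- up to symmetries of the hexagon, both mark points are on edge `0`, and `t` is a direct copy
  -- of `s`
  obtain ⟨g', a, c, hg', ht₁⟩ : ∃ (g' : TileState) (a : Circle) (c : ℂ),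
      g'.edgePerm 0 = l ∧ ∀ z, place t 0 g' z = s₁ (a * z + c) := by
    obtain ⟨a, ha⟩ := linear_isometry_complex
      ((place t 0 (l, false)).trans s₁.symm).linearIsometryEquiv
    have hz : ∀ z, place t 0 (l, false) z =
        s₁ (((place t 0 (l, false)).trans s₁.symm).linearIsometryEquiv z +
          s₁.symm (place t 0 (l, false) 0)) := by
      intro z
      have := ((place t 0 (l, false)).trans s₁.symm).map_vadd 0 z
      rw [vadd_eq_add, add_zero, vadd_eq_add] at this
      exact (s₁.symm_apply_eq.1 this)
    rcases ha with ha | ha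
    · refine ⟨(l, false), a, s₁.symm (place t 0 (l, false) 0), (k0 l).1, fun z => ?_⟩
      rw [hz z, ha, rotation_apply]
    · refine ⟨(l, true), a, s₁.symm (place t 0 (l, false) 0), (k0 l).2, fun z => ?_⟩
      have e : place t 0 (l, true) z = place t 0 (l, false) ((starRingEnd ℂ) z) := by
        simp [place_apply, TileState.iso]
      rw [e, hz, ha, LinearIsometryEquiv.trans_apply, rotation_apply, Complex.conjLIE_apply,
        Complex.conj_conj]
  obtain ⟨b'', hb''⟩ : ∃ b'', xor g'.2 b'' = b' := ⟨xor g'.2 b', by simp⟩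
  have hp : (a : ℂ) * markPoint 0 b'' + c = markPoint 0 b := by
    apply s₁.injective
    rw [← ht₁, hs₁, place_apply, place_apply, TileState.iso_markPoint, TileState.iso_markPoint, hg',
      hb'', (k0 k).1, zero_add, zero_add, ← h]
    simp
  have ha := eq_neg_one_of_disjoint (a := a) (c := c) (fun z hz hz' => by
    have h1 := hregion s (k, false) hz'
    rw [← hs₁, ← ht₁] at h1
    exact Set.disjoint_left.1 hd h1 (hregion t g' hz)) hp
  have hc : c = markPoint 0 b + markPoint 0 b'' := by rw [← hp, ha]; ring
  have inv : ∀ g : TileState, ∃ g' : TileState, g.mul g' = (0, false) := by decide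
  obtain ⟨g'', hg''⟩ := inv g'
  have ht : t = place (place s₁ c (3, false)) 0 g'' := by
    have e : place t 0 g' = place s₁ c (3, false) := by
      have key : TileState.iso (3, false) = LinearIsometryEquiv.neg ℝ := by
        have : ∀ k, vertex (TileState.vertexPerm (3, false) k) = -vertex k := by
          intro k
          rw [← vertex_add_three, add_comm]
          rfl
        apply linearIsometry_ext <;> rw [TileState.iso_vertex, this] <;> rfl
      ext z
      rw [ht₁, place_apply, key, ha]
      congr 1
      change _ = c + -z
      ring
    rw [← e, place_place, hg'', map_zero, add_zero, place_zero]
  rw [hs₁, place_place, map_zero, add_zero, place_place] at ht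
  refine ⟨_, _, ht, ?_⟩
  rw [zero_add, hc, map_add, TileState.iso_markPoint, TileState.iso_markPoint, (k0 k).1]
  simp only [Bool.false_bne]
  rw [emb_neighbor]
  cases b <;> cases b'' <;> simp [markPoint, edgePoint] <;> ring_nf <;> simp

/-- At each of its edges a tile meets another one with which it shares the edge, or against which it
is displaced by half an edge. -/
theorem IsAllowedTiling.exists_adjacent {T : Set PlacedTile} (hT : IsAllowedTiling T)
    {s : PlacedTile} (hs : s ∈ T) (k : Fin 6) : ∃ g c, place s c g ∈ T ∧
      (c = 2 * markPoint k (TileState.stripeBit (0, false) k) ∨ c = emb (neighbor k)) := by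
  obtain ⟨t, ht, hne, q, hq, e⟩ := hT.2.1 s hs _ (mem_stripeEnds_iff.2 ⟨k, rfl⟩)
  obtain ⟨l, rfl⟩ := mem_stripeEnds_iff.1 hq
  obtain ⟨g, c, rfl, hc⟩ := exists_eq_place_of_disjoint (hT.1.2 s hs t ht hne.symm) e.symm
  exact ⟨g, c, ht, hc⟩

theorem place_center (F : PlacedTile) (c : ℂ) (g : TileState) : place F c g 0 = F c := by
  rw [place_apply, map_zero, add_zero]

/-- Three tiles around a gap: the point in the middle between the three centres would have to be
covered by a fourth tile, for which there is no room. -/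
theorem IsTiling.no_gap {T : Set PlacedTile} (hT : IsTiling T) {s : PlacedTile} {c d : ℂ}
    {g h : TileState} (hs : s ∈ T) (hc : place s c g ∈ T) (hd : place s d h ∈ T)
    (h0 : 9 < Complex.normSq (c + d)) (h1 : 9 < Complex.normSq (2 * c - d))
    (h2 : 9 < Complex.normSq (2 * d - c))
    (h3 : Complex.normSq c + Complex.normSq d - Complex.normSq (c + d) / 3 < 6) : False := by
  obtain ⟨v, hv, hdist⟩ := hT.exists_dist_le_one (s ((c + d) / 3))
  obtain ⟨z, hz⟩ := s.surjective (v 0)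
  rw [← hz, s.dist_map, dist_eq_norm] at hdist
  have hsq : Complex.normSq ((c + d) / 3 - z) ≤ 1 := by
    rw [Complex.normSq_eq_norm_sq]
    exact pow_le_one₀ (norm_nonneg _) hdist
  have far : ∀ {w : ℂ} {k : TileState}, place s w k ∈ T →
      1 < Complex.normSq ((c + d) / 3 - w) → 3 ≤ Complex.normSq (z - w) := by
    intro w k hw h1
    have hne : v ≠ place s w k := by
      rintro rfl
      rw [place_center] at hz
      rw [s.injective hz] at hsq
      linarith
    have := hT.sqrt3_le_dist hv hw hne
    rw [place_center, ← hz, s.dist_map, dist_eq_norm] at this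
    rw [Complex.normSq_eq_norm_sq]
    nlinarith [sqrt3_sq, sqrt3_pos]
  have f0 := far (w := 0) (k := (0, false)) (by rwa [place_zero]) (by
    rw [sub_zero, Complex.normSq_div]; norm_num; linarith)
  have f1 := far hc (by
    rw [show (c + d) / 3 - c = -(2 * c - d) / 3 by ring, Complex.normSq_div, Complex.normSq_neg]
    norm_num; linarith)
  have f2 := far hd (by
    rw [show (c + d) / 3 - d = -(2 * d - c) / 3 by ring, Complex.normSq_div, Complex.normSq_neg]
    norm_num; linarith)
  have key : Complex.normSq (z - 0) + Complex.normSq (z - c) + Complex.normSq (z - d) =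
      3 * Complex.normSq ((c + d) / 3 - z) +
        (Complex.normSq c + Complex.normSq d - Complex.normSq (c + d) / 3) := by
    simp [Complex.normSq_apply]
    ring
  linarith

/-- A displacement by half an edge would leave a gap in the form of a triangle of side `1 / 2`. -/
theorem IsAllowedTiling.no_half_shift {T : Set PlacedTile} (hT : IsAllowedTiling T)
    {s : PlacedTile} (hs : s ∈ T) {k : Fin 6} {b : Bool} {g : TileState}
    (h : place s (2 * markPoint k b) g ∈ T) : False := by
  -- the edge `m` of the displaced tile is the one that bounds the gap
  obtain ⟨m, hm⟩ : ∃ m, m = if b then k + 4 else k + 2 := ⟨_, rfl⟩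
  obtain ⟨l, hl⟩ := g.exists_edgePerm_eq m
  obtain ⟨g', c, hu, hc⟩ := hT.exists_adjacent h l
  rw [place_place] at hu
  obtain ⟨B, hB, hB'⟩ : ∃ B, 6 * g.iso c = emb B ∧ ((∃ b', B = markVector m b') ∨
      B = 6 • neighbor m) := by
    rcases hc with rfl | rfl
    · refine ⟨markVector m (xor g.2 (TileState.stripeBit (0, false) l)), ?_, Or.inl ⟨_, rfl⟩⟩
      rw [← twelve_mul_markPoint, two_mul, map_add, TileState.iso_markPoint, hl]
      ring
    · refine ⟨6 • neighbor m, ?_, Or.inr rfl⟩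
      rw [TileState.iso_emb_neighbor, hl, map_nsmul, nsmul_eq_mul]
      norm_num
  have hA : 6 * (2 * markPoint k b) = emb (markVector k b) := by
    rw [← twelve_mul_markPoint]; ring
  have nsq : ∀ {w : ℂ} {X : ℤ × ℤ}, 6 * w = emb X → Complex.normSq w = normForm X / 12 := by
    intro w X hw
    have := congrArg Complex.normSq hw
    rw [normSq_emb, Complex.normSq_mul] at this
    norm_num [Complex.normSq_apply] at this ⊢
    linarith
  set A := markVector k b with hAdef
  have hD : 6 * (2 * markPoint k b + g.iso c) = emb (A + B) := by rw [map_add, ← hA, ← hB]; ring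
  have nD := nsq hD
  -- the third tile overlaps the first one, or there is a gap between the three tiles
  have key : (0 < normForm (A + B) ∧ normForm (A + B) < 36) ∨ (108 < normForm (A + (A + B)) ∧
      108 < normForm (A + A - (A + B)) ∧ 108 < normForm (A + B + (A + B) - A) ∧
      3 * normForm A + 3 * normForm (A + B) - normForm (A + (A + B)) < 216) := by
    rw [hAdef]
    rcases hB' with ⟨b', rfl⟩ | rfl <;> rw [hm]
    · clear * -
      revert k b b'; decide
    · clear * -
      revert k b; decide
  rcases key with ⟨h1, h2⟩ | ⟨h1, h2, h3, h4⟩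
  · have hne : s ≠ place s (2 * markPoint k b + g.iso c) (g.mul g') := by
      intro e
      have e' := congrArg (fun t : PlacedTile => t 0) e
      simp only [place_center] at e'
      rw [← s.injective e', map_zero] at nD
      have : (0 : ℝ) < normForm (A + B) := by exact_mod_cast h1
      linarith
    have hd := hT.1.sqrt3_le_dist hs hu hne
    rw [place_center, s.dist_map, dist_eq_norm, zero_sub, norm_neg] at hd
    rw [Complex.normSq_eq_norm_sq] at nD
    have : (normForm (A + B) : ℝ) < 36 := by exact_mod_cast h2
    nlinarith [sqrt3_sq, sqrt3_pos]
  · have e1 := nsq (w := 2 * markPoint k b + (2 * markPoint k b + g.iso c)) (X := A + (A + B))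
      (by rw [map_add, ← hA, ← hD]; ring)
    refine hT.1.no_gap hs h hu ?_ ?_ ?_ ?_
    · rw [e1]
      have : (108 : ℝ) < normForm (A + (A + B)) := by exact_mod_cast h1
      linarith
    · rw [nsq (X := A + A - (A + B)) (by rw [map_sub, map_add, ← hA, ← hD]; ring)]
      have : (108 : ℝ) < normForm (A + A - (A + B)) := by exact_mod_cast h2
      linarith
    · rw [nsq (X := A + B + (A + B) - A) (by rw [map_sub, map_add emb (A + B), ← hA, ← hD]; ring)]
      have : (108 : ℝ) < normForm (A + B + (A + B) - A) := by exact_mod_cast h3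
      linarith
    · rw [nsq hA, nD, e1]
      have : (3 * normForm A + 3 * normForm (A + B) - normForm (A + (A + B)) : ℝ) < 216 := by
        exact_mod_cast h4
      linarith

/-- Every tile shares each of its edges with another tile. -/
theorem IsAllowedTiling.exists_neighbor {T : Set PlacedTile} (hT : IsAllowedTiling T)
    {s : PlacedTile} (hs : s ∈ T) (k : Fin 6) : ∃ g, place s (emb (neighbor k)) g ∈ T := by
  obtain ⟨g, c, h, rfl | rfl⟩ := hT.exists_adjacent hs k
  · exact (hT.no_half_shift hs h).elim
  · exact ⟨g, h⟩

/-- The honeycomb that contains one tile `F` of an allowed tiling is occupied by tiles. -/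
theorem IsAllowedTiling.exists_place_emb {T : Set PlacedTile} (hT : IsAllowedTiling T)
    {F : PlacedTile} (hF : F ∈ T) (x : ℤ × ℤ) : ∃ g, place F (emb x) g ∈ T := by
  have step : ∀ k x, (∃ g, place F (emb x) g ∈ T) → ∃ g, place F (emb (x + neighbor k)) g ∈ T := by
    rintro k x ⟨g, hg⟩
    obtain ⟨l, rfl⟩ := g.exists_edgePerm_eq k
    obtain ⟨h, hh⟩ := hT.exists_neighbor hg l
    rw [place_place, TileState.iso_emb_neighbor, ← map_add] at hh
    exact ⟨_, hh⟩
  obtain ⟨p, q⟩ := x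
  have h0 : ∃ g, place F (emb (0, 0)) g ∈ T := ⟨(0, false), by
    rw [show emb (0, 0) = 0 from map_zero emb, place_zero]; exact hF⟩
  have hp : ∀ p : ℤ, ∃ g, place F (emb (p, 0)) g ∈ T := by
    intro p
    induction p with
    | zero => exact h0
    | succ n ih => simpa [neighbor] using step 0 _ ih
    | pred n ih => simpa [neighbor, ← sub_eq_add_neg] using step 3 _ ih
  induction q with
  | zero => exact hp p
  | succ n ih => simpa [neighbor] using step 2 _ ih
  | pred n ih => simpa [neighbor, ← sub_eq_add_neg] using step 5 _ ih

/-- An allowed tiling is given by a configuration of tile states on the triangular lattice. -/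
theorem IsAllowedTiling.exists_eq_range {T : Set PlacedTile} (hT : IsAllowedTiling T) :
    ∃ (F : PlacedTile) (G : ℤ × ℤ → TileState), T = Set.range fun x => place F (emb x) (G x) := by
  obtain ⟨F, hF, -⟩ := hT.1.exists_dist_le_one 0
  choose G hG using hT.exists_place_emb hF
  refine ⟨F, G, Set.Subset.antisymm (fun t ht => ?_) (by rintro _ ⟨x, rfl⟩; exact hG x)⟩
  obtain ⟨z, hz⟩ := F.surjective (t 0)
  obtain ⟨x, hx⟩ := exists_sub_emb_mem_hexagon z
  refine ⟨x, ?_⟩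
  by_contra hne
  have h1 := hT.1.sqrt3_le_dist ht (hG x) (Ne.symm hne)
  rw [place_center, ← hz, F.dist_map, dist_eq_norm] at h1
  have h2 := norm_le_one_of_mem_hexagon hx
  nlinarith [sqrt3_sq, sqrt3_pos]

/-! ### The matching rules on the honeycomb -/

/-- A mark point belongs to only two hexagons of the honeycomb. -/
theorem eq_or_eq_of_emb_add_markPoint {x y : ℤ × ℤ} {k l : Fin 6} {s t : Bool}
    (h : emb y + markPoint l t = emb x + markPoint k s) :
    y = x ∨ (y = x + neighbor k ∧ l = k + 3 ∧ t = !s) := by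
  have h12 : 12 • y + markVector l t = 12 • x + markVector k s := by
    apply emb_injective
    rw [map_add, map_add, map_nsmul, map_nsmul, ← twelve_mul_markPoint, ← twelve_mul_markPoint,
      nsmul_eq_mul, nsmul_eq_mul]
    push_cast
    linear_combination 12 * h
  have key : ∀ k l s t, (markVector k s - markVector l t).1 % 12 = 0 →
      (markVector k s - markVector l t).2 % 12 = 0 → markVector k s - markVector l t = 0 ∨
        markVector k s - markVector l t = 12 • neighbor k ∧ l = k + 3 ∧ t = !s := by decide
  have h1 := congrArg Prod.fst h12
  have h2 := congrArg Prod.snd h12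
  simp only [Prod.fst_add, Prod.snd_add, Prod.smul_fst, Prod.smul_snd] at h1 h2
  simp only [nsmul_eq_mul, Nat.cast_ofNat] at h1 h2
  rcases key k l s t (by rw [Prod.fst_sub]; omega) (by rw [Prod.snd_sub]; omega) with h | ⟨h, hl⟩
  · left
    have e1 := congrArg Prod.fst h
    have e2 := congrArg Prod.snd h
    simp only [Prod.fst_sub, Prod.snd_sub, Prod.fst_zero, Prod.snd_zero] at e1 e2
    exact Prod.ext (by omega) (by omega)
  · refine Or.inr ⟨?_, hl⟩
    have e1 := congrArg Prod.fst h
    have e2 := congrArg Prod.snd h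
    simp only [Prod.fst_sub, Prod.snd_sub, Prod.smul_fst, Prod.smul_snd] at e1 e2
    simp only [nsmul_eq_mul, Nat.cast_ofNat] at e1 e2
    exact Prod.ext (by rw [Prod.fst_add]; omega) (by rw [Prod.snd_add]; omega)

/-- The rules in a honeycomb of tiles imply the combinatorial rules. -/
theorem IsAllowedTiling.obeysRules {F : PlacedTile} {G : ℤ × ℤ → TileState}
    (hT : IsAllowedTiling (Set.range fun x => place F (emb x) (G x))) : ObeysRules G where
  stripe x k := by
    obtain ⟨p, hp, hpk⟩ := (G x).iso_stripeEnds.2 ⟨k, rfl⟩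
    obtain ⟨_, ⟨y, rfl⟩, hne, q, hq, e⟩ := hT.2.1 _ ⟨x, rfl⟩ p hp
    obtain ⟨l, hl⟩ := (G y).iso_stripeEnds.1 ⟨q, hq, rfl⟩
    simp only [place_apply] at e
    have e' := F.injective e
    rw [hpk, hl] at e'
    rcases eq_or_eq_of_emb_add_markPoint e' with rfl | ⟨rfl, rfl, h⟩
    · exact absurd rfl hne
    · exact h
  flag x m := by
    obtain ⟨k, hk⟩ := (G x).exists_vertexPerm_eq m
    obtain ⟨l, hl⟩ := (G (x + corner m)).exists_vertexPerm_eq (m + 3)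
    have two : ∀ (g : TileState) k, g.iso (2 * vertex k) = 2 * vertex (g.vertexPerm k) := by
      intro g k
      rw [two_mul, two_mul, map_add, TileState.iso_vertex]
    have e := hT.2.2 _ ⟨x, rfl⟩ _ ⟨x + corner m, rfl⟩ k l (by
      simp only [place_apply]
      rw [two, hk, TileState.iso_vertex, hl, vertex_add_three, map_add emb, ← three_mul_vertex]
      congr 1; ring) (by
      simp only [place_apply]
      rw [two, hl, TileState.iso_vertex, hk, vertex_add_three, map_add emb, ← three_mul_vertex]
      congr 1; ring)
    rw [place_linear, place_linear] at e
    have e' := F.linearIsometryEquiv.injective e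
    rw [TileState.iso_flag, TileState.iso_flag, hk, hl, vertex_add_three] at e'
    have hv : Complex.I * vertex m ≠ 0 := by
      rw [← norm_pos_iff, norm_mul, norm_vertex, Complex.norm_I]; norm_num
    change (G (x + corner m)).flagBit (m + 3) = _
    cases h1 : (G x).flagBit m <;> cases h2 : (G (x + corner m)).flagBit (m + 3) <;>
      simp only [h1, h2, if_true, Bool.false_eq_true, if_false, Bool.not_true,
        Bool.not_false] at e' ⊢
    · exact absurd (by linear_combination -e' / 2) hv
    · exact absurd (by linear_combination e' / 2) hv

theorem abs_lt_one_of_mem_interior_hexagon {z : ℂ} (hz : z ∈ interior hexagon) :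
    |2 * (z.re / √3)| < 1 ∧ |z.re / √3 + z.im| < 1 ∧ |z.re / √3 - z.im| < 1 := by
  have hc : ContinuousAt (fun t : ℝ => (t : ℂ) * z) 1 := by fun_prop
  have hn : interior hexagon ∈ nhds (((1 : ℝ) : ℂ) * z) := by
    rw [Complex.ofReal_one, one_mul]
    exact isOpen_interior.mem_nhds hz
  -- a dilate `t * z` with `1 < t` is still in the hexagon
  obtain ⟨t, ht, ht1⟩ :=
    (((hc.eventually hn).filter_mono nhdsWithin_le_nhds).and
      (self_mem_nhdsWithin (s := Set.Ioi 1))).exists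
  have h := mem_hexagon_iff.1 (interior_subset ht)
  change 1 < t at ht1
  have lt : ∀ u v : ℝ, v = t * u → |v| ≤ 1 → |u| < 1 := by
    intro u v hv h1
    rw [hv, abs_mul, abs_of_pos (by linarith)] at h1
    nlinarith [abs_nonneg u]
  rw [Complex.re_ofReal_mul, Complex.im_ofReal_mul] at h
  exact ⟨lt _ _ (by ring) h.1, lt _ _ (by ring) h.2.1, lt _ _ (by ring) h.2.2⟩

/-- The hexagons of the honeycomb do not overlap. -/
theorem eq_of_mem_interior_hexagon {z : ℂ} {x y : ℤ × ℤ} (hx : z - emb x ∈ interior hexagon)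
    (hy : z - emb y ∈ interior hexagon) : x = y := by
  have h3 := sqrt3_pos.ne'
  obtain ⟨a0, a1, a2⟩ := abs_lt_one_of_mem_interior_hexagon hx
  obtain ⟨b0, b1, b2⟩ := abs_lt_one_of_mem_interior_hexagon hy
  simp only [Complex.sub_re, Complex.sub_im, emb_re, emb_im, sub_div, mul_div_cancel_left₀ _ h3,
    abs_lt] at a0 a1 a2 b0 b1 b2
  have d0 : (2 * (x.1 - y.1) - (x.2 - y.2) : ℝ) < 2 := by linarith
  have d0' : (-2 : ℝ) < 2 * (x.1 - y.1) - (x.2 - y.2) := by linarith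
  have d1 : ((x.1 - y.1) + (x.2 - y.2) : ℝ) < 2 := by linarith
  have d1' : (-2 : ℝ) < (x.1 - y.1) + (x.2 - y.2) := by linarith
  have d2 : ((x.1 - y.1) - 2 * (x.2 - y.2) : ℝ) < 2 := by linarith
  have d2' : (-2 : ℝ) < (x.1 - y.1) - 2 * (x.2 - y.2) := by linarith
  norm_cast at d0 d0' d1 d1' d2 d2'
  exact Prod.ext (by omega) (by omega)

/-- A configuration that obeys the combinatorial rules is an allowed tiling. -/
theorem ObeysRules.isAllowedTiling {G : ℤ × ℤ → TileState} (hG : ObeysRules G) :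
    IsAllowedTiling (Set.range fun x => place (AffineIsometryEquiv.refl ℝ ℂ) (emb x) (G x)) := by
  have mem : ∀ x z, z ∈ (place (AffineIsometryEquiv.refl ℝ ℂ) (emb x) (G x)).region ↔
      z - emb x ∈ hexagon := by
    intro x z
    constructor
    · rintro ⟨w, hw, rfl⟩
      change emb x + (G x).iso w - emb x ∈ hexagon
      rw [add_sub_cancel_left, ← (G x).iso_hexagon]
      exact ⟨w, hw, rfl⟩
    · intro hz
      rw [← (G x).iso_hexagon] at hz
      obtain ⟨w, hw, hwz⟩ := hz
      refine ⟨w, hw, ?_⟩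
      change emb x + (G x).iso w = z
      rw [hwz]; ring
  refine ⟨⟨?_, ?_⟩, ?_, ?_⟩
  · refine Set.eq_univ_of_forall fun z => ?_
    obtain ⟨x, hx⟩ := exists_sub_emb_mem_hexagon z
    exact Set.mem_biUnion ⟨x, rfl⟩ ((mem x z).2 hx)
  · rintro _ ⟨x, rfl⟩ _ ⟨y, rfl⟩ hne
    rw [Set.disjoint_left]
    intro z hx hy
    have reg : ∀ x, (place (AffineIsometryEquiv.refl ℝ ℂ) (emb x) (G x)).region =
        (fun z => z - emb x) ⁻¹' hexagon := fun x => Set.ext (mem x)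
    rw [reg] at hx hy
    have pre : ∀ x, z ∈ interior ((fun z => z - emb x) ⁻¹' hexagon) →
        z - emb x ∈ interior hexagon := by
      intro x h
      have e := (Homeomorph.subRight (emb x)).preimage_interior hexagon
      change z ∈ (Homeomorph.subRight (emb x)) ⁻¹' interior hexagon
      rwa [e]
    rw [eq_of_mem_interior_hexagon (pre x hx) (pre y hy)] at hne
    exact hne rfl
  · rintro _ ⟨x, rfl⟩ p hp
    obtain ⟨k, hk⟩ := (G x).iso_stripeEnds.1 ⟨p, hp, rfl⟩
    obtain ⟨q, hq, hqk⟩ := (G (x + neighbor k)).iso_stripeEnds.2 ⟨k + 3, rfl⟩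
    refine ⟨_, ⟨x + neighbor k, rfl⟩, fun e => ?_, q, hq, ?_⟩
    · have h0 := emb_injective (place_injective e).1
      have key : ∀ k, neighbor k ≠ 0 := by decide
      exact key k (by simpa using h0)
    · simp only [place_apply]
      rw [hk, hqk, hG.stripe]
      have key : ∀ k s, 12 • neighbor k + markVector (k + 3) (!s) = markVector k s := by decide
      have h := congrArg emb (key k ((G x).stripeBit k))
      rw [map_add, map_nsmul, ← twelve_mul_markPoint, ← twelve_mul_markPoint, nsmul_eq_mul] at h
      push_cast at h
      rw [map_add emb]
      congr 1
      linear_combination h / 12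
  · rintro _ ⟨x, rfl⟩ _ ⟨y, rfl⟩ k l h1 h2
    simp only [place_apply, AffineIsometryEquiv.coe_refl, id_eq, two_mul, map_add,
      TileState.iso_vertex] at h1 h2
    rw [place_linear, place_linear, TileState.iso_flag, TileState.iso_flag]
    set m := (G x).vertexPerm k
    set n := (G y).vertexPerm l
    have hn : vertex n = vertex (m + 3) := by
      rw [vertex_add_three]
      linear_combination h1 + h2
    have hn := vertex_injective hn
    have hy : y = x + corner m := by
      apply emb_injective
      rw [map_add, ← three_mul_vertex]
      rw [hn, vertex_add_three] at h1
      linear_combination -h1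
    have := hG.flag x m
    rw [hn, hy, corner, this, vertex_add_three]
    cases (G x).flagBit m <;> simp

/-! ### Partial translational symmetries -/

theorem trans_rotateTranslate_one_apply (t : PlacedTile) (e z : ℂ) :
    t.trans (rotateTranslate 1 e) z = t z + e := by
  simp [rotateTranslate, add_comm e]

theorem place_trans_rotateTranslate (F : PlacedTile) (y e : ℤ × ℤ) (g : TileState) :
    (place F (emb y) g).trans (rotateTranslate 1 (F.linearIsometryEquiv (emb e))) =
      place F (emb (y + e)) g := by
  ext z
  have h := F.map_vadd (emb y + g.iso z) (emb e)
  rw [vadd_eq_add, vadd_eq_add] at h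
  rw [trans_rotateTranslate_one_apply, place_apply, place_apply, map_add emb,
    add_comm (emb y) (emb e), add_assoc, h, add_comm]

/-- A tile that participates in a translational symmetry is repeated along a whole line of
lattice points. -/
theorem PartialTranslationalSymmetry.exists_forall_zsmul {F : PlacedTile} {G : ℤ × ℤ → TileState}
    (p : PartialTranslationalSymmetry (Set.range fun x => place F (emb x) (G x))) {y : ℤ × ℤ}
    (hy : place F (emb y) (G y) ∈ p.participants) :
    ∃ e : ℤ × ℤ, e ≠ 0 ∧ ‖emb e‖ = p.spacing ∧ ∀ j : ℤ, G (y + j • e) = G y := by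
  have hrot : p.rot = 1 :=
    Circle.ext (by
      rw [Circle.coe_one]
      exact mul_right_cancel₀ p.disp_ne_zero (by rw [p.rot_disp, one_mul]))
  have hinv := p.invariant
  rw [hrot] at hinv
  obtain ⟨e, he⟩ : ∃ e, p.disp = F.linearIsometryEquiv (emb e) := by
    have h : (place F (emb y) (G y)).trans (rotateTranslate 1 p.disp) ∈ p.participants :=
      hinv ▸ Set.mem_image_of_mem _ hy
    obtain ⟨x, hx⟩ := p.participants_subset h
    refine ⟨x - y, ?_⟩
    have h0 := congrArg (fun t : PlacedTile => t 0) hx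
    simp only [trans_rotateTranslate_one_apply, place_center] at h0
    have h1 := F.map_vsub (emb x) (emb y)
    rw [vsub_eq_sub, vsub_eq_sub, h0] at h1
    rw [map_sub emb, h1, add_sub_cancel_left]
  rw [he] at hinv
  have hiff : ∀ w, place F (emb w) (G y) ∈ p.participants ↔
      place F (emb (w + e)) (G y) ∈ p.participants := by
    intro w
    rw [← place_trans_rotateTranslate]
    constructor
    · intro h
      exact hinv ▸ Set.mem_image_of_mem _ h
    · intro h
      rw [← hinv] at h
      obtain ⟨t, ht, e'⟩ := h
      have : t = place F (emb w) (G y) := by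
        ext z
        have := congrArg (fun u : PlacedTile => u z) e'
        simpa using this
      exact this ▸ ht
  have hall : ∀ j : ℤ, place F (emb (y + j • e)) (G y) ∈ p.participants := by
    intro j
    induction j with
    | zero => simpa using hy
    | succ i ih =>
      rw [hiff, add_assoc] at ih
      rwa [add_smul, one_smul]
    | pred i ih =>
      rw [hiff, add_assoc, sub_smul, one_smul, sub_add_cancel]
      exact ih
  refine ⟨e, ?_, ?_, fun j => ?_⟩
  · rintro rfl
    exact p.disp_ne_zero (by rw [he, map_zero emb, map_zero])
  · rw [PartialTranslationalSymmetry.spacing, he, LinearIsometryEquiv.norm_map]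
  · obtain ⟨x, hx⟩ := p.participants_subset (hall j)
    obtain ⟨h1, h2⟩ := place_injective hx
    rw [← emb_injective h1, h2]

theorem numIndependent_eq_zero {T : Set PlacedTile} {t : PlacedTile} {r : ℝ}
    (h : ∀ p : PartialTranslationalSymmetry T, p.spacing < r → t ∉ p.participants) :
    numIndependent T t r = 0 := by
  refine le_antisymm (iSup₂_le fun P hP => ?_) bot_le
  rw [Set.eq_empty_of_forall_notMem fun p hp => h p (hP.2 p hp).1 (hP.2 p hp).2]
  simp

/-! ### Counting tiles -/

theorem sq_norm_emb (x : ℤ × ℤ) :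
    ‖emb x‖ ^ 2 = 3 * ((x.1 : ℝ) ^ 2 - x.1 * x.2 + x.2 ^ 2) := by
  rw [← Complex.normSq_eq_norm_sq, normSq_emb, normForm]
  push_cast
  rfl

theorem abs_le_norm_emb (x : ℤ × ℤ) : |(x.1 : ℝ)| ≤ ‖emb x‖ ∧ |(x.2 : ℝ)| ≤ ‖emb x‖ := by
  have h := sq_norm_emb x
  constructor <;> apply abs_le_of_sq_le_sq _ (norm_nonneg _) <;> rw [h]
  · nlinarith [sq_nonneg ((x.1 : ℝ) - 2 * x.2), sq_nonneg (x.1 : ℝ)]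
  · nlinarith [sq_nonneg (2 * (x.1 : ℝ) - x.2), sq_nonneg (x.2 : ℝ)]

theorem norm_emb_le (x : ℤ × ℤ) : ‖emb x‖ ≤ 2 * (|(x.1 : ℝ)| + |(x.2 : ℝ)|) := by
  have h := sq_norm_emb x
  refine abs_le_of_sq_le_sq' ?_ (by positivity) |>.2
  have := neg_abs_le ((x.1 : ℝ) * x.2)
  rw [abs_mul] at this
  rw [h, ← sq_abs (x.1 : ℝ), ← sq_abs (x.2 : ℝ)]
  nlinarith [sq_nonneg |(x.1 : ℝ)|, sq_nonneg |(x.2 : ℝ)|,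
    mul_nonneg (abs_nonneg (x.1 : ℝ)) (abs_nonneg (x.2 : ℝ))]

theorem norm_emb_sub_le (F : PlacedTile) (x : ℤ × ℤ) : ‖emb x‖ - ‖F 0‖ ≤ ‖F (emb x)‖ := by
  rw [← dist_apply_center F, dist_eq_norm]
  linarith [norm_sub_le (F (emb x)) (F 0)]

theorem norm_apply_emb_le (F : PlacedTile) (x : ℤ × ℤ) : ‖F (emb x)‖ ≤ ‖F 0‖ + ‖emb x‖ := by
  rw [← dist_apply_center F (emb x), dist_eq_norm]
  linarith [norm_sub_norm_le (F (emb x)) (F 0)]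

/-- The number of tiles within distance `ρ` of the origin grows at most quadratically; the constant
is not optimal. -/
theorem finite_tilesWithin_range (F : PlacedTile) (G : ℤ × ℤ → TileState) {ρ : ℝ}
    (hρ : 2 * ‖F 0‖ + 1 ≤ ρ) :
    (tilesWithin (Set.range fun x => place F (emb x) (G x)) ρ).Finite ∧
      ((tilesWithin (Set.range fun x => place F (emb x) (G x)) ρ).ncard : ℝ) ≤ (3 * ρ) ^ 2 := by
  have h0 := norm_nonneg (F 0)
  set N := ⌊ρ + ‖F 0‖⌋₊
  have hN : (N : ℝ) ≤ ρ + ‖F 0‖ := Nat.floor_le (by linarith)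
  set box : Finset (ℤ × ℤ) := Finset.Icc (-N : ℤ) N ×ˢ Finset.Icc (-N : ℤ) N
  have hsub : tilesWithin (Set.range fun x => place F (emb x) (G x)) ρ ⊆
      (fun x => place F (emb x) (G x)) '' box := by
    rintro _ ⟨⟨x, rfl⟩, hx⟩
    refine ⟨x, ?_, rfl⟩
    rw [place_center] at hx
    have hx' := norm_emb_sub_le F x
    have hle : ∀ n : ℤ, |(n : ℝ)| ≤ ‖emb x‖ → -(N : ℤ) ≤ n ∧ n ≤ N := by
      intro n hn
      rw [← abs_le, ← Int.natCast_natAbs]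
      refine Int.ofNat_le.2 (Nat.le_floor ?_)
      rw [Nat.cast_natAbs, Int.cast_abs]
      linarith
    obtain ⟨h1, h2⟩ := abs_le_norm_emb x
    simp only [box, Finset.coe_product, Finset.coe_Icc, Set.mem_prod, Set.mem_Icc]
    exact ⟨hle _ h1, hle _ h2⟩
  have hfin : ((fun x => place F (emb x) (G x)) '' (box : Set (ℤ × ℤ))).Finite :=
    box.finite_toSet.image _
  refine ⟨hfin.subset hsub, ?_⟩
  have hcard := (Set.ncard_le_ncard hsub hfin).trans (Set.ncard_image_le box.finite_toSet)
  have hbox : box.card = (2 * N + 1) ^ 2 := by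
    rw [Finset.card_product, Int.card_Icc, sq]
    congr <;> omega
  rw [Set.ncard_coe_finset, hbox] at hcard
  calc _ ≤ (((2 * N + 1) ^ 2 : ℕ) : ℝ) := by exact_mod_cast hcard
    _ = (2 * (N : ℝ) + 1) ^ 2 := by push_cast; ring
    _ ≤ (3 * ρ) ^ 2 := by gcongr; linarith

/-- The tiles in a coset of a multiple of the lattice are a positive fraction of all tiles. -/
theorem exists_le_fractionWithin (F : PlacedTile) (G : ℤ × ℤ → TileState) {M : ℕ} (hM : 0 < M)
    (x : ℤ × ℤ) {A : Set PlacedTile}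
    (hA : ∀ z : ℤ × ℤ, place F (emb (x + (M : ℤ) • z)) (G (x + (M : ℤ) • z)) ∈ A) :
    ∃ c : ℝ, 0 < c ∧ ∀ᶠ ρ : ℝ in Filter.atTop,
      c ≤ fractionWithin (Set.range fun x => place F (emb x) (G x)) A ρ := by
  have hM' : (0 : ℝ) < M := Nat.cast_pos.2 hM
  refine ⟨1 / (24 * M) ^ 2, by positivity, ?_⟩
  filter_upwards [Filter.eventually_ge_atTop (2 * (‖F 0‖ + ‖emb x‖) + 1)] with ρ hρ
  have h0 := norm_nonneg (F 0)
  have h1 := norm_nonneg (emb x)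
  obtain ⟨hfin, hcard⟩ := finite_tilesWithin_range F G (ρ := ρ) (by linarith)
  set S := tilesWithin (Set.range fun x => place F (emb x) (G x)) ρ
  set K := ⌊(ρ - ‖F 0‖ - ‖emb x‖) / (4 * M)⌋₊
  have hK : (K : ℝ) * (4 * M) ≤ ρ - ‖F 0‖ - ‖emb x‖ :=
    (le_div_iff₀ (by positivity)).1 (Nat.floor_le (div_nonneg (by linarith) (by positivity)))
  have hK' : ρ / (8 * M) ≤ K + 1 := by
    refine le_trans ?_ (Nat.lt_floor_add_one _).le
    rw [div_le_div_iff₀ (by positivity) (by positivity)]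
    nlinarith
  -- the sites of the coset with index in this box are within distance `ρ`
  set box : Finset (ℤ × ℤ) := Finset.Icc (0 : ℤ) K ×ˢ Finset.Icc (0 : ℤ) K
  set Φ : ℤ × ℤ → PlacedTile := fun z => place F (emb (x + (M : ℤ) • z)) (G (x + (M : ℤ) • z))
  have hΦ : Φ.Injective := by
    intro z w hzw
    exact smul_right_injective _ (Int.natCast_ne_zero.2 hM.ne')
      (add_left_cancel (emb_injective (place_injective hzw).1))
  have hsub : Φ '' box ⊆ S ∩ A := by
    rintro _ ⟨z, hz, rfl⟩
    refine ⟨⟨⟨_, rfl⟩, ?_⟩, hA z⟩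
    simp only [box, Finset.coe_product, Finset.coe_Icc, Set.mem_prod, Set.mem_Icc] at hz
    obtain ⟨⟨z1, z1'⟩, z2, z2'⟩ := hz
    have z1 : (0 : ℝ) ≤ z.1 := by exact_mod_cast z1
    have z2 : (0 : ℝ) ≤ z.2 := by exact_mod_cast z2
    have z1' : (z.1 : ℝ) ≤ K := by exact_mod_cast z1'
    have z2' : (z.2 : ℝ) ≤ K := by exact_mod_cast z2'
    rw [place_center]
    refine (norm_apply_emb_le F _).trans ?_
    have hz := norm_emb_le z
    rw [abs_of_nonneg z1, abs_of_nonneg z2] at hz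
    have hs : ‖emb ((M : ℤ) • z)‖ = M * ‖emb z‖ := by
      rw [map_zsmul, zsmul_eq_mul, norm_mul, Int.cast_natCast, Complex.norm_natCast]
    have := norm_add_le (emb x) (emb ((M : ℤ) • z))
    rw [hs, ← map_add emb] at this
    nlinarith
  have hle := Set.ncard_le_ncard hsub (hfin.inter_of_left A)
  have hbox : box.card = (K + 1) ^ 2 := by
    rw [Finset.card_product, Int.card_Icc, sq]
    rfl
  rw [Set.ncard_image_of_injective _ hΦ, Set.ncard_coe_finset, hbox] at hle
  have hpos : 0 < S.ncard :=
    ((by positivity : 0 < (K + 1) ^ 2).trans_le hle).trans_le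
      (Set.ncard_le_ncard Set.inter_subset_left hfin)
  rw [fractionWithin, le_div_iff₀ (Nat.cast_pos.2 hpos)]
  calc 1 / (24 * M) ^ 2 * (S.ncard : ℝ) ≤ 1 / (24 * M) ^ 2 * (3 * ρ) ^ 2 := by gcongr
    _ = (ρ / (8 * M)) ^ 2 := by field_simp; ring
    _ ≤ ((K : ℝ) + 1) ^ 2 := by gcongr; exact div_nonneg (by linarith) (by positivity)
    _ = (((K + 1) ^ 2 : ℕ) : ℝ) := by push_cast; ring
    _ ≤ _ := by exact_mod_cast hle

/-- The tiles of a suitable coset participate in no symmetry of spacing less than `r`. -/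
theorem IsAllowedTiling.isNonperiodic {T : Set PlacedTile} (hT : IsAllowedTiling T) :
    IsNonperiodic T := by
  intro r
  obtain ⟨F, G, rfl⟩ := hT.exists_eq_range
  obtain ⟨m, hm⟩ := pow_unbounded_of_one_lt r (one_lt_two : (1 : ℝ) < 2)
  have hm' : r < 2 ^ (m + 1) := hm.trans_le (pow_le_pow_right₀ one_le_two m.le_succ)
  obtain ⟨M, x, hM, hx⟩ := hT.obeysRules.isSolution.exists_coset m.succ_pos
  refine exists_le_fractionWithin F G hM x fun z => ?_
  rw [Set.mem_ofPred_eq, numIndependent_eq_zero]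
  · exact two_pos
  intro p hp hmem
  obtain ⟨e, he, hn, hall⟩ := p.exists_forall_zsmul hmem
  have hlt : ∀ n : ℤ, |(n : ℝ)| ≤ ‖emb e‖ → |n| < 2 ^ (m + 1) := by
    intro n h
    have : |(n : ℝ)| < 2 ^ (m + 1) := by linarith
    exact_mod_cast this
  obtain ⟨j, hj⟩ := hx z e he (hlt _ (abs_le_norm_emb e).1) (hlt _ (abs_le_norm_emb e).2)
  exact hj (congrArg TileState.type (hall j))

end SocolarTaylor

end

theorem mainTheorem1 :
    (∃ T : Set SocolarTaylor.PlacedTile, SocolarTaylor.IsAllowedTiling T) ∧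
      ∀ T : Set SocolarTaylor.PlacedTile,
        SocolarTaylor.IsAllowedTiling T → SocolarTaylor.IsNonperiodic T := by
  refine ⟨?_, fun T hT => hT.isNonperiodic⟩
  obtain ⟨G, hG⟩ := SocolarTaylor.toeplitz_isSolution.exists_obeysRules
  exact ⟨_, hG.isAllowedTiling⟩
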